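/- Let $\mathbb D=\{|z|<1\}$, $\mathbb D_e=\{|z|>1\}$, $\mathbb T=\{|z|=1\}$. Let $V$ be a closed isometric operator (with domain $D(V)$ and range $R(V)$, not necessarily dense) in a complex Hilbert space $H$ with identity operator $E$. Put $M_\zeta=(E-\zeta V)D(V)$ for $\zeta\in\mathbb C$, $M_\infty=R(V)$, and $N_\zeta=H\ominus M_\zeta$; here $1/\overline{z_0}=\infty$ when $z_0=0$. Denote by $P_L$ the orthogonal projection of $H$ onto a subspace $L$. A generalized resolvent of $V$ is a function $\mathbf R_z=P_H(E_{\widetilde H}-zU)^{-1}|_H$, $|z|\neq1$, where $U\supseteq V$ is a unitary operator in a Hilbert space $\widetilde H\supseteq H$. A point $\mu$ is of regular type for $V$ if $V-\mu E$ has a bounded inverse on its range. For $z_0\in\mathbb D$ let $V_{z_0}=(V-\overline{z_0}E)(E-z_0V)^{-1}$, an isometric operator from $M_{z_0}$ onto $M_{1/\overline{z_0}}$, and for a bounded operator $C:N_{z_0}\to N_{1/\overline{z_0}}$ let $V^+_{z_0;C}=V_{z_0}\oplus C$ and $V_{C;z_0}=(V^+_{z_0;C}+\overline{z_0}E)(E+z_0V^+_{z_0;C})^{-1}$.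 Let $\mathcal S(N_{z_0};N_{1/\overline{z_0}})$ be the set of analytic functions on $\mathbb D$ whose values are linear contractions from $N_{z_0}$ to $N_{1/\overline{z_0}}$. A function $C(\lambda;z_0)\in\mathcal S(N_{z_0};N_{1/\overline{z_0}})$ corresponds to $\mathbf R_z$ by Inin's formula if $\mathbf R_\lambda=(E-\lambda V_{C(\lambda;z_0);z_0})^{-1}$ for all $\lambda\in\mathbb D$. **Theorem.** Let $V$ be a closed isometric operator in a Hilbert space $H$, and let $\Delta$ be an open arc of $\mathbb T$ such that $\zeta^{-1}$ is a point of regular type of $V$ for every $\zeta\in\Delta$. Let $z_0\in\mathbb D$, put $\Delta_1=\{\frac{\lambda-z_0}{1-\overline{z_0}\lambda}:\lambda\in\Delta\}$, and suppose that $$P_{M_{1/\overline{z_0}}}\,M_{\frac{z_0+\zeta}{1+\zeta\overline{z_0}}}=M_{1/\overline{z_0}}\qquad\text{for all }\zeta\in\Delta_1 .$$ Let $\mathbf R_z$ be a generalized resolvent of $V$, and let $C(\lambda;z_0)\in\mathcal S(N_{z_0};N_{1/\overline{z_0}})$ correspond to it by Inin's formula. Then $\mathbf R_z$ has an analytic continuation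 to $\mathbb D\cup\mathbb D_e\cup\Delta$ if and only if the following three conditions hold: 1. $C(\lambda;z_0)$ has an extension to $\mathbb D\cup\Delta$ that is continuous in the uniform operator topology; 2. for every $\lambda\in\Delta$ the extended $C(\lambda;z_0)$ maps $N_{z_0}$ isometrically onto $N_{1/\overline{z_0}}$; 3. for every $\lambda\in\Delta$ the operator $C(\lambda;z_0)-W_{\lambda;z_0}$ is invertible (injective), and $(C(\lambda;z_0)-W_{\lambda;z_0})N_{z_0}=N_{1/\overline{z_0}}$, where $W_{\lambda;z_0}$ is the operator with domain $P_{N_{z_0}}N_\lambda$ defined by $$W_{\lambda;z_0}P_{N_{z_0}}f=\frac{1-\overline{z_0}\lambda}{\lambda-z_0}\,P_{N_{1/\overline{z_0}}}f,\qquad f\in N_\lambda .$$ -/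

import Mathlib

open Complex ComplexConjugate Set

noncomputable section

namespace IsometricGap

universe u

variable {H : Type u} [NormedAddCommGroup H] [InnerProductSpace ℂ H]

/-- `V`, an operator in `H` with domain `V.domain` (not necessarily dense), is closed and
isometric. -/
structure IsClosedIsometric (V : H →ₗ.[ℂ] H) : Prop where
  isClosed : V.IsClosed
  norm_map : ∀ x : V.domain, ‖V x‖ = ‖(x : H)‖

/-- `μ` is a point of the regular type of `V`: the operator `V - μ E` has a bounded inverse,
defined on the range of `V - μ E`. -/
def IsRegularType (V : H →ₗ.[ℂ] H) (μ : ℂ) : Prop :=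
  ∃ k : ℝ, 0 < k ∧ ∀ x : V.domain, k * ‖(x : H)‖ ≤ ‖V x - μ • (x : H)‖

/-- `M_ζ = (E - ζ V) D(V)` for complex `ζ`, and `M_∞ = R(V)`. -/
def M (V : H →ₗ.[ℂ] H) : OnePoint ℂ → Submodule ℂ H
  | none => LinearMap.range V.toFun
  | some ζ => LinearMap.range (V.domain.subtype - ζ • V.toFun)

/-- `N_ζ = H ⊖ M_ζ`. -/
def N (V : H →ₗ.[ℂ] H) (ζ : OnePoint ℂ) : Submodule ℂ H := (M V ζ)ᗮ

/-- The point `1 / conj z` of the extended complex plane, equal to `∞` for `z = 0`. -/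
def invConj (z : ℂ) : OnePoint ℂ :=
  if z = 0 then OnePoint.infty else ((1 / conj z : ℂ) : OnePoint ℂ)

/-- An open arc of the unit circle (the whole circle is allowed). -/
def IsOpenArc (Δ : Set ℂ) : Prop :=
  ∃ a b : ℝ, a < b ∧ Δ = (fun t : ℝ => exp (t * I)) '' Ioo a b

section aux

variable {V : H →ₗ.[ℂ] H}

lemma mem_M_coe {ζ : ℂ} {y : H} :
    y ∈ M V (ζ : OnePoint ℂ) ↔ ∃ f : V.domain, (f : H) - ζ • V f = y := by
  change y ∈ LinearMap.range (V.domain.subtype - ζ • V.toFun) ↔ _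
  simp [LinearMap.mem_range]

lemma mem_M_invConj {z : ℂ} {y : H} :
    y ∈ M V (invConj z) ↔ ∃ f : V.domain, V f - conj z • (f : H) = y := by
  by_cases hz : z = 0
  · subst hz
    simp only [invConj, if_true, map_zero, zero_smul, sub_zero]
    change y ∈ LinearMap.range V.toFun ↔ _
    simp [LinearMap.mem_range]
  · have hc : conj z ≠ 0 := by simpa using hz
    rw [invConj, if_neg hz, mem_M_coe]
    constructor
    · rintro ⟨f, rfl⟩
      refine ⟨-(conj z)⁻¹ • f, ?_⟩
      rw [LinearPMap.map_smul, Submodule.coe_smul, smul_smul]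
      simp [hc]
      abel
    · rintro ⟨f, rfl⟩
      refine ⟨-conj z • f, ?_⟩
      rw [LinearPMap.map_smul, Submodule.coe_smul, smul_smul]
      simp [hc]
      abel

lemma norm_sub_smul_ge (hV : IsClosedIsometric V) (z : ℂ) (f : V.domain) :
    (1 - ‖z‖) * ‖(f : H)‖ ≤ ‖(f : H) - z • V f‖ := by
  have h := norm_sub_norm_le (f : H) (z • V f)
  rw [norm_smul, hV.norm_map] at h
  linarith

/-- The identity behind the fact that `V_z` is isometric. -/
lemma norm_cayley (hV : IsClosedIsometric V) (z : ℂ) (f : V.domain) :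
    ‖V f - conj z • (f : H)‖ = ‖(f : H) - z • V f‖ := by
  have h : ‖V f - conj z • (f : H)‖ ^ 2 = ‖(f : H) - z • V f‖ ^ 2 := by
    rw [@norm_sub_sq ℂ, @norm_sub_sq ℂ, norm_smul, norm_smul, hV.norm_map f,
      inner_smul_right, inner_smul_right, ← inner_conj_symm (V f) (f : H), ← map_mul,
      RCLike.conj_re, RCLike.norm_conj]
  exact (sq_eq_sq₀ (norm_nonneg _) (norm_nonneg _)).1 h

lemma injective_sub_smul (hV : IsClosedIsometric V) {z : ℂ} (hz : ‖z‖ < 1) :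
    Function.Injective (V.domain.subtype - z • V.toFun) := by
  rw [injective_iff_map_eq_zero]
  intro f hf
  have h := norm_sub_smul_ge hV z f
  have h0 : (f : H) - z • V f = 0 := by simpa using hf
  rw [h0, norm_zero] at h
  have : ‖(f : H)‖ ≤ 0 := by
    by_contra hc
    push Not at hc
    nlinarith
  simpa using this

variable [CompleteSpace H]

lemma isClosed_M (hV : IsClosedIsometric V) {z : ℂ} (hz : ‖z‖ < 1) :
    IsClosed (M V (z : OnePoint ℂ) : Set H) := by
  have hg : IsClosed (V.graph : Set (H × H)) := hV.isClosed
  have : CompleteSpace V.graph := hg.completeSpace_coe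
  let φ : V.graph →L[ℂ] H :=
    ((ContinuousLinearMap.fst ℂ H H) - z • ContinuousLinearMap.snd ℂ H H) ∘L V.graph.subtypeL
  have hφ : AntilipschitzWith (Real.toNNReal (1 - ‖z‖)⁻¹) φ := by
    apply AddMonoidHomClass.antilipschitz_of_bound
    rintro ⟨⟨x, y⟩, hxy⟩
    obtain ⟨f, hf1, hf2⟩ := (LinearPMap.mem_graph_iff V).1 hxy
    simp only at hf1 hf2
    subst hf1 hf2
    have h := norm_sub_smul_ge hV z f
    have h1 : 0 < 1 - ‖z‖ := by linarith
    rw [Real.coe_toNNReal _ (inv_nonneg.2 h1.le), ← div_eq_inv_mul, le_div_iff₀ h1]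
    simpa [φ, Prod.norm_def, hV.norm_map f, mul_comm] using h
  have hr := hφ.isClosed_range φ.uniformContinuous
  convert hr using 1
  ext y
  rw [SetLike.mem_coe, mem_M_coe]
  constructor
  · rintro ⟨f, rfl⟩
    exact ⟨⟨(f, V f), LinearPMap.mem_graph V f⟩, by simp [φ]⟩
  · rintro ⟨⟨⟨x, w⟩, hxw⟩, rfl⟩
    obtain ⟨f, hf1, hf2⟩ := (LinearPMap.mem_graph_iff V).1 hxw
    simp only at hf1 hf2
    subst hf1 hf2
    exact ⟨f, by simp [φ]⟩

end aux

section extension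

variable {V : H →ₗ.[ℂ] H}

/-- The isometric operator `V_z = (V - conj z E) (E - z V)⁻¹`, `|z| < 1`, with the domain `M_z`. -/
def cayley (hV : IsClosedIsometric V) {z : ℂ} (hz : ‖z‖ < 1) :
    M V (z : OnePoint ℂ) →ₗᵢ[ℂ] H where
  toLinearMap := (V.toFun - conj z • V.domain.subtype) ∘ₗ
    ((LinearEquiv.ofInjective _ (injective_sub_smul hV hz)).symm :
      LinearMap.range (V.domain.subtype - z • V.toFun) →ₗ[ℂ] V.domain)
  norm_map' y := by
    obtain ⟨f, rfl⟩ := (LinearEquiv.ofInjective _ (injective_sub_smul hV hz)).surjective y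
    change ‖(V.toFun - conj z • V.domain.subtype)
      ((LinearEquiv.ofInjective _ (injective_sub_smul hV hz)).symm
        ((LinearEquiv.ofInjective _ (injective_sub_smul hV hz)) f))‖ = ‖(f : H) - z • V f‖
    rw [LinearEquiv.symm_apply_apply]
    exact norm_cayley hV z f

variable [CompleteSpace H]

/-- `V⁺_{z;C} = V_z ⊕ C` with respect to `H = M_z ⊕ N_z`, for a bounded operator `C` from `N_z` to
`N_{1 / conj z}`. -/
def plus (hV : IsClosedIsometric V) {z : ℂ} (hz : ‖z‖ < 1)
    (C : N V (z : OnePoint ℂ) →L[ℂ] N V (invConj z)) : H →L[ℂ] H :=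
  have : (M V (z : OnePoint ℂ)).HasOrthogonalProjection :=
    have := (isClosed_M hV hz).completeSpace_coe
    inferInstance
  (cayley hV hz).toContinuousLinearMap ∘L (M V (z : OnePoint ℂ)).orthogonalProjectionOnto +
    (N V (invConj z)).subtypeL ∘L C ∘L
      (M V (z : OnePoint ℂ))ᗮ.orthogonalProjectionOnto

/-- The orthogonal extension `V_{C;z} = (V⁺_{z;C} + conj z E) (E + z V⁺_{z;C})⁻¹` of `V`. -/
def orthogonalExtension (hV : IsClosedIsometric V) {z : ℂ} (hz : ‖z‖ < 1)
    (C : N V (z : OnePoint ℂ) →L[ℂ] N V (invConj z)) : H →L[ℂ] H :=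
  (plus hV hz C + conj z • 1) * Ring.inverse (1 + z • plus hV hz C)

end extension

/-- `R` is a generalized resolvent of `V`: there are a Hilbert space `K`, containing `H` through
the isometric embedding `J`, and a unitary operator `U ⊇ V` in `K`, with
`R z = P^K_H (E_K - z U)⁻¹ |_H` for `|z| ≠ 1`. The adjoint of `J` is the orthogonal projection
of `K` onto `H`. -/
def IsGeneralizedResolvent [CompleteSpace H] (V : H →ₗ.[ℂ] H) (R : ℂ → H →L[ℂ] H) : Prop :=
  ∃ (K : Type u) (_ : NormedAddCommGroup K) (_ : InnerProductSpace ℂ K) (_ : CompleteSpace K)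
    (J : H →ₗᵢ[ℂ] K) (U : unitary (K →L[ℂ] K)),
    (∀ x : V.domain, (U : K →L[ℂ] K) (J x) = J (V x)) ∧
    ∀ z : ℂ, ‖z‖ ≠ 1 →
      R z = J.toContinuousLinearMap.adjoint ∘L
        Ring.inverse (1 - z • (U : K →L[ℂ] K)) ∘L J.toContinuousLinearMap

/-- The class `S(H₁; H₂)` of contraction-valued functions analytic in the open unit disc. -/
structure IsSchur {H₁ H₂ : Submodule ℂ H} (C : ℂ → H₁ →L[ℂ] H₂) : Prop where
  analytic : AnalyticOnNhd ℂ C (Metric.ball 0 1)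
  norm_le_one : ∀ ζ ∈ Metric.ball (0 : ℂ) 1, ‖C ζ‖ ≤ 1

/-- `C(·; z₀)` corresponds to `R` by the formula `R_ζ = (E - ζ V_{C(ζ; z₀); z₀})⁻¹`, `|ζ| < 1`. -/
def CorrespondsTo [CompleteSpace H] {V : H →ₗ.[ℂ] H} (hV : IsClosedIsometric V) {z₀ : ℂ}
    (hz₀ : ‖z₀‖ < 1) (C : ℂ → N V (z₀ : OnePoint ℂ) →L[ℂ] N V (invConj z₀))
    (R : ℂ → H →L[ℂ] H) : Prop :=
  IsSchur C ∧ ∀ ζ ∈ Metric.ball (0 : ℂ) 1,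
    R ζ = Ring.inverse (1 - ζ • orthogonalExtension hV hz₀ (C ζ))

section W

variable [CompleteSpace H]

instance (V : H →ₗ.[ℂ] H) (ζ : OnePoint ℂ) : (N V ζ).HasOrthogonalProjection :=
  inferInstanceAs (M V ζ)ᗮ.HasOrthogonalProjection

/-- The graph of `W_{lam;z₀}`: the pairs
`(P_{N_{z₀}} f, (1 - conj z₀ lam) / (lam - z₀) P_{N_{1 / conj z₀}} f)` with `f ∈ N_lam`. -/
def WGraph (V : H →ₗ.[ℂ] H) (z₀ lam : ℂ) : Submodule ℂ (H × H) :=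
  (N V (lam : OnePoint ℂ)).map
    ((N V (z₀ : OnePoint ℂ)).starProjection.prod
      (((1 - conj z₀ * lam) / (lam - z₀)) • (N V (invConj z₀)).starProjection) :
        H →ₗ[ℂ] H × H)

/-- The operator `W_{lam;z₀}`, with the domain `P_{N_{z₀}} N_lam`. -/
def W (V : H →ₗ.[ℂ] H) (z₀ lam : ℂ) : H →ₗ.[ℂ] H := (WGraph V z₀ lam).toLinearPMap

/-- `W_{lam;z₀}` is well defined for `|lam| = 1`. -/
lemma WGraph_functional {V : H →ₗ.[ℂ] H} (hV : IsClosedIsometric V) {z₀ lam : ℂ}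
    (hz₀ : ‖z₀‖ < 1) (hlam : ‖lam‖ = 1) (p : H × H) (hp : p ∈ WGraph V z₀ lam)
    (h0 : p.1 = 0) : p.2 = 0 := by
  obtain ⟨f, hf, rfl⟩ := hp
  have h0' : (N V (z₀ : OnePoint ℂ)).starProjection f = 0 := h0
  change ((1 - conj z₀ * lam) / (lam - z₀)) • (N V (invConj z₀)).starProjection f = 0
  have hfM : f ∈ M V (z₀ : OnePoint ℂ) := by
    have := (isClosed_M hV hz₀).completeSpace_coe
    have h1 : f ∈ (N V (z₀ : OnePoint ℂ))ᗮ :=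
      (Submodule.starProjection_apply_eq_zero_iff _).1 h0'
    rwa [N, Submodule.orthogonal_orthogonal] at h1
  obtain ⟨g, hg⟩ := mem_M_coe.1 hfM
  set f' := V g - conj z₀ • (g : H) with hf'
  have hn : ‖f'‖ = ‖f‖ := by rw [hf', norm_cayley hV, hg]
  set a : ℂ := 1 - conj z₀ * lam
  set b : ℂ := lam - z₀
  have hll : lam * conj lam = 1 := by rw [mul_conj', hlam]; simp
  have hab : ‖a‖ = ‖b‖ := by
    have : a = lam * conj b := by simp only [a, b, map_sub]; linear_combination -hll
    rw [this, norm_mul, hlam, one_mul, norm_conj]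
  have hb : b ≠ 0 := by
    intro h
    have : lam = z₀ := sub_eq_zero.1 h
    rw [this] at hlam
    linarith
  have hid : a • f - b • f' = (1 - z₀ * conj z₀) • ((g : H) - lam • V g) := by
    rw [← hg, hf']
    simp only [a, b]
    module
  have horth : inner ℂ f (a • f - b • f') = 0 := by
    rw [hid, inner_smul_right, Submodule.inner_left_of_mem_orthogonal
      (mem_M_coe.2 ⟨g, rfl⟩) hf, mul_zero]
  have heq : a • f = b • f' := by
    have h1 : inner ℂ (a • f) (b • f') = ((‖a • f‖ ^ 2 : ℝ) : ℂ) := by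
      rw [inner_sub_right, sub_eq_zero] at horth
      rw [inner_smul_left, ← horth, ← inner_smul_left, inner_self_eq_norm_sq_to_K]
      norm_cast
    have h2 : ‖a • f - b • f'‖ ^ 2 = 0 := by
      rw [@norm_sub_sq ℂ, h1, norm_smul b, norm_smul a, hn, hab]
      simp only [RCLike.re_eq_complex_re, ofReal_re]
      ring
    exact sub_eq_zero.1 (norm_eq_zero.1 (pow_eq_zero_iff (two_ne_zero)|>.1 h2))
  have ha : a ≠ 0 := by
    rw [← norm_ne_zero_iff, hab]
    exact norm_ne_zero_iff.2 hb
  have hfM' : f ∈ M V (invConj z₀) := by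
    have h1 : f = (a⁻¹ * b) • f' := by rw [mul_smul, ← heq, smul_smul, inv_mul_cancel₀ ha, one_smul]
    rw [h1]
    exact Submodule.smul_mem _ _ (mem_M_invConj.2 ⟨g, rfl⟩)
  have : (N V (invConj z₀)).starProjection f = 0 :=
    (Submodule.starProjection_apply_eq_zero_iff _).2 (Submodule.le_orthogonal_orthogonal _ hfM')
  rw [this, smul_zero]

/-- A bounded operator `C` from `N_{z₀}` to `N_{1 / conj z₀}`, regarded as an operator in `H` with
the domain `N_{z₀}`. -/
def toPMap {H₁ H₂ : Submodule ℂ H} (C : H₁ →L[ℂ] H₂) : H →ₗ.[ℂ] H :=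
  ⟨H₁, H₂.subtype ∘ₗ (C : H₁ →ₗ[ℂ] H₂)⟩

/-- The orthogonal projection of `H` onto (the closure of) a subspace. For a closed isometric `V`
and `|z| < 1` it is applied to `M_{1 / conj z}`, which is closed. -/
def proj (L : Submodule ℂ H) : H →L[ℂ] H := L.topologicalClosure.starProjection

end W

end IsometricGap

end

/-! Write `T = V⁺_{z₀;C}`, a contraction inside the disc. Inin's formula turns into `R_lam = (1 + z₀
T) A⁻¹`, where `A = (1 - conj z₀ lam) - (lam - z₀) T` is the pencil. The theorem splits into an
analytic and a geometric half, both phrased through `T` and `A`: continuation of `R` across `Δ` is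
equivalent to a norm-continuous extension of `C` to `Δ` for which `T` is unitary and `A` invertible
there.

Analytic half. A generalized resolvent satisfies `R_z⋆ = 1 - R_{1 / conj z}`, so a limit on the
circle must satisfy `R + R⋆ = 1`; when `A` is invertible and `|lam| = 1` this says exactly that `T`
is unitary (`pencilResolvent_add_star_iff`). Given the extension of `C`, the boundary values from
inside and outside therefore agree, and a Painlevé-type argument gives analyticity. Conversely `A⁻¹`
is an affine function of `R` (`smul_pencilResolvent`), so it is continuous up to `Δ`. Since `A`
stays bounded, the limit of `A⁻¹` is invertible (`isUnit_of_tendsto`), and `T`, then `C`, can be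
read off from it.

Geometric half. `T` is unitary exactly when `C` is isometric and onto. For `|lam| = 1` the pencil
takes `M_{z₀}` to `M_lam`. Its compression to a map from `M_{z₀}` to `M_{1 / conj z₀}` is injective
by regular type and onto by the projection hypothesis. That hypothesis also gives `P_{N_{z₀}} N_lam
= N_{z₀}`, so `W` is defined on all of `N_{z₀}`. On vectors of `N_lam` the pencil is `-(lam - z₀) (C
- W) P_{N_{z₀}}`. Hence it is block triangular, and it is bijective exactly when `C - W` is
(`isUnit_pencil_plus_iff`). -/

noncomputable section

namespace IsometricGap

open Filter Topology

/-! ### Painlevé's theorem across a circular arc, for Banach-valued functions -/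

section painleve

variable {E : Type*} [NormedAddCommGroup E] [NormedSpace ℂ E] [CompleteSpace E]

/-- A continuous function on an open set that is holomorphic off the real line is holomorphic. -/
lemma differentiableOn_of_continuousOn_of_off_real {U : Set ℂ} (hU : IsOpen U) {f : ℂ → E}
    (hc : ContinuousOn f U) (hd : ∀ z ∈ U, z.im ≠ 0 → DifferentiableAt ℂ f z) :
    DifferentiableOn ℂ f U := by
  refine (isConservativeOn_and_continuousOn_iff_isDifferentiableOn hU).1 ⟨fun z w hzw => ?_, hc⟩
  rw [← add_eq_zero_iff_eq_neg, wedgeIntegral_add_wedgeIntegral_eq]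
  -- For a rectangle whose interior misses the real line, Cauchy's theorem needs only continuity on
  -- the closed rectangle. A rectangle straddling the line is cut along it into two such pieces.
  have key : ∀ z w : ℂ, uIcc z.re w.re ×ℂ uIcc z.im w.im ⊆ U →
      (0 : ℝ) ∉ Ioo (min z.im w.im) (max z.im w.im) →
      (∫ x : ℝ in z.re..w.re, f (x + z.im * I)) - (∫ x : ℝ in z.re..w.re, f (x + w.im * I)) +
      I • (∫ y : ℝ in z.im..w.im, f (re w + y * I)) -
      I • (∫ y : ℝ in z.im..w.im, f (re z + y * I)) = 0 := by
    intro z w hzw h0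
    refine integral_boundary_rect_eq_zero_of_continuousOn_of_differentiableOn f z w
      (hc.mono hzw) fun s hs => (hd s (hzw ⟨?_, ?_⟩) ?_).differentiableWithinAt
    · exact Ioo_subset_Icc_self hs.1
    · exact Ioo_subset_Icc_self hs.2
    · intro h
      exact h0 (h ▸ hs.2)
  by_cases h0 : (0 : ℝ) ∈ Ioo (min z.im w.im) (max z.im w.im)
  · have h0' : (0 : ℝ) ∈ uIcc z.im w.im := Ioo_subset_Icc_self h0
    have hl : uIcc z.im 0 ⊆ uIcc z.im w.im := uIcc_subset_uIcc left_mem_uIcc h0'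
    have hr : uIcc 0 w.im ⊆ uIcc z.im w.im := uIcc_subset_uIcc h0' right_mem_uIcc
    have h1 := key z ⟨w.re, 0⟩ (fun s hs => hzw ⟨hs.1, hl hs.2⟩)
      (fun h => by rcases le_total z.im 0 with h' | h' <;> simp [h'] at h)
    have h2 := key ⟨z.re, 0⟩ w (fun s hs => hzw ⟨hs.1, hr hs.2⟩)
      (fun h => by rcases le_total w.im 0 with h' | h' <;> simp [h'] at h)
    have hint : ∀ x ∈ uIcc z.re w.re, ∀ p q : ℝ, uIcc p q ⊆ uIcc z.im w.im →
        IntervalIntegrable (fun y : ℝ => f (x + y * I)) MeasureTheory.volume p q := by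
      intro x hx p q hpq
      refine ContinuousOn.intervalIntegrable (hc.comp (by fun_prop) fun y hy => hzw ⟨?_, ?_⟩)
      · simpa using hx
      · simpa using hpq hy
    rw [← intervalIntegral.integral_add_adjacent_intervals
        (hint _ right_mem_uIcc _ _ hl) (hint _ right_mem_uIcc _ _ hr),
      ← intervalIntegral.integral_add_adjacent_intervals
        (hint _ left_mem_uIcc _ _ hl) (hint _ left_mem_uIcc _ _ hr), smul_add, smul_add]
    simp only at h1 h2
    have h := congr($h1 + $h2)
    rw [add_zero] at h
    rw [← h]
    abel
  · exact key z w hzw h0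

/-- A function which is continuous on the union of an open arc and the complement of the unit
circle and holomorphic off the circle is holomorphic across the arc. -/
lemma analyticOnNhd_of_continuousOn_of_off_circle {Δ : Set ℂ} (hΔ : IsOpenArc Δ) {f : ℂ → E}
    (hc : ContinuousOn f ({z : ℂ | ‖z‖ < 1} ∪ {z : ℂ | 1 < ‖z‖} ∪ Δ))
    (hd : ∀ z, ‖z‖ ≠ 1 → AnalyticAt ℂ f z) :
    AnalyticOnNhd ℂ f ({z : ℂ | ‖z‖ < 1} ∪ {z : ℂ | 1 < ‖z‖} ∪ Δ) := by
  rintro z (hz | hz)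
  · exact hd z (hz.elim (fun h => ne_of_lt h) fun h => ne_of_gt h)
  obtain ⟨a, b, -, rfl⟩ := hΔ
  obtain ⟨t, ht, rfl⟩ := hz
  -- `s ↦ exp (s I)` straightens the arc: on this vertical strip real points go to the arc, the
  -- upper half to the disc, the lower half to its exterior.
  set U : Set ℂ := {s : ℂ | s.re ∈ Ioo a b}
  have hU : IsOpen U := isOpen_Ioo.preimage continuous_re
  have hnorm : ∀ s : ℂ, ‖exp (s * I)‖ = Real.exp (-s.im) := fun s => by
    rw [norm_exp]; simp
  have hmaps : MapsTo (fun s : ℂ => exp (s * I)) U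
      ({z : ℂ | ‖z‖ < 1} ∪ {z : ℂ | 1 < ‖z‖} ∪ (fun t : ℝ => exp (t * I)) '' Ioo a b) := by
    intro s hs
    rcases lt_trichotomy s.im 0 with h | h | h
    · left; right
      simpa [hnorm] using h
    · right
      refine ⟨s.re, hs, ?_⟩
      have : ((s.re : ℝ) : ℂ) = s := by apply Complex.ext <;> simp [h]
      simp only [this]
    · left; left
      simpa [hnorm] using h
  have hg : DifferentiableOn ℂ (fun s : ℂ => f (exp (s * I))) U := by
    refine differentiableOn_of_continuousOn_of_off_real hU
      (hc.comp (by fun_prop) hmaps) fun s _ hs => ?_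
    refine (hd _ ?_).differentiableAt.comp s (by fun_prop)
    rw [hnorm]
    simpa using hs
  have hga : AnalyticAt ℂ (fun s : ℂ => f (exp (s * I))) (t : ℂ) :=
    hg.analyticAt (hU.mem_nhds (by simpa [U] using ht))
  -- A local inverse of `s ↦ exp (s I)`. Dividing by the centre puts the argument of `log` near `1`,
  -- away from the branch cut.
  set ψ : ℂ → ℂ := fun z => t - I * log (z * (exp (t * I))⁻¹) with hψ
  have hψt : ψ (exp (t * I)) = t := by simp [hψ]
  have hψa : AnalyticAt ℂ ψ (exp (t * I)) := by
    refine analyticAt_const.sub (analyticAt_const.mul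
      ((analyticAt_id.mul analyticAt_const).clog ?_))
    simp
  have hcomp : AnalyticAt ℂ ((fun s : ℂ => f (exp (s * I))) ∘ ψ) (exp (t * I)) :=
    AnalyticAt.comp (by rwa [hψt]) hψa
  refine hcomp.congr ?_
  have hne : ∀ᶠ z in 𝓝 (exp (t * I)), z ≠ 0 := eventually_ne_nhds (exp_ne_zero _)
  filter_upwards [hne] with z hz
  have h1 : ψ z * I = t * I + log (z * (exp (t * I))⁻¹) := by
    simp only [hψ]
    linear_combination (-log (z * (exp (t * I))⁻¹)) * I_mul_I
  simp only [Function.comp, h1]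
  rw [exp_add, exp_log (by simp [hz]), mul_comm z, mul_inv_cancel_left₀ (exp_ne_zero _)]

end painleve

/-! ### The operator `V⁺_{z;C}` and its block structure -/

section plus

variable {H : Type*} [NormedAddCommGroup H] [InnerProductSpace ℂ H]
  {V : H →ₗ.[ℂ] H} (hV : IsClosedIsometric V) {z : ℂ} (hz : ‖z‖ < 1)

lemma cayley_apply (f : V.domain) :
    cayley hV hz ⟨(f : H) - z • V f, mem_M_coe.2 ⟨f, rfl⟩⟩ = V f - conj z • (f : H) := by
  have h : (⟨(f : H) - z • V f, mem_M_coe.2 ⟨f, rfl⟩⟩ : M V (z : OnePoint ℂ)) =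
      LinearEquiv.ofInjective _ (injective_sub_smul hV hz) f := Subtype.ext rfl
  rw [h]
  change (V.toFun - conj z • V.domain.subtype)
      ((LinearEquiv.ofInjective _ (injective_sub_smul hV hz)).symm
        ((LinearEquiv.ofInjective _ (injective_sub_smul hV hz)) f)) = _
  rw [LinearEquiv.symm_apply_apply]
  rfl

lemma range_cayley : LinearMap.range (cayley hV hz).toLinearMap = M V (invConj z) := by
  ext y
  rw [mem_M_invConj]
  constructor
  · rintro ⟨⟨x, hx⟩, rfl⟩
    obtain ⟨f, rfl⟩ := mem_M_coe.1 hx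
    exact ⟨f, (cayley_apply hV hz f).symm⟩
  · rintro ⟨f, rfl⟩
    exact ⟨_, cayley_apply hV hz f⟩

lemma inner_eq_zero_of_mem {ζ : OnePoint ℂ} {x y : H} (hx : x ∈ M V ζ) (hy : y ∈ N V ζ) :
    inner ℂ x y = 0 :=
  Submodule.inner_right_of_mem_orthogonal hx hy

lemma eq_zero_of_mem_of_mem {ζ : OnePoint ℂ} {x : H} (hx : x ∈ M V ζ) (hy : x ∈ N V ζ) :
    x = 0 :=
  inner_self_eq_zero.1 (inner_eq_zero_of_mem hx hy)

lemma norm_add_sq_of_mem {ζ : OnePoint ℂ} {F n : H} (hF : F ∈ M V ζ) (hn : n ∈ N V ζ) :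
    ‖F + n‖ ^ 2 = ‖F‖ ^ 2 + ‖n‖ ^ 2 := by
  rw [sq, norm_add_sq_eq_norm_sq_add_norm_sq_of_inner_eq_zero _ _ (inner_eq_zero_of_mem hF hn),
    sq, sq]

variable [CompleteSpace H]

lemma hasOrthogonalProjection_M (hV : IsClosedIsometric V) (hz : ‖z‖ < 1) :
    (M V (z : OnePoint ℂ)).HasOrthogonalProjection :=
  have := (isClosed_M hV hz).completeSpace_coe
  inferInstance

lemma isClosed_M_invConj (hV : IsClosedIsometric V) (hz : ‖z‖ < 1) :
    IsClosed (M V (invConj z) : Set H) := by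
  have := (isClosed_M hV hz).completeSpace_coe
  rw [← range_cayley hV hz]
  exact (cayley hV hz).isometry.isClosedEmbedding.isClosed_range

lemma hasOrthogonalProjection_M_invConj (hV : IsClosedIsometric V) (hz : ‖z‖ < 1) :
    (M V (invConj z)).HasOrthogonalProjection :=
  have := (isClosed_M_invConj hV hz).completeSpace_coe
  inferInstance

lemma exists_eq_add (hV : IsClosedIsometric V) (hz : ‖z‖ < 1) (x : H) :
    ∃ F ∈ M V (z : OnePoint ℂ), ∃ n ∈ N V (z : OnePoint ℂ), x = F + n := by
  have := hasOrthogonalProjection_M hV hz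
  exact (M V (z : OnePoint ℂ)).exists_add_mem_mem_orthogonal x

lemma exists_eq_add_invConj (hV : IsClosedIsometric V) (hz : ‖z‖ < 1) (x : H) :
    ∃ F ∈ M V (invConj z), ∃ n ∈ N V (invConj z), x = F + n := by
  have := hasOrthogonalProjection_M_invConj hV hz
  exact (M V (invConj z)).exists_add_mem_mem_orthogonal x

variable (C : N V (z : OnePoint ℂ) →L[ℂ] N V (invConj z))

lemma plus_apply_M (x : M V (z : OnePoint ℂ)) : plus hV hz C x = cayley hV hz x := by
  have := hasOrthogonalProjection_M hV hz
  change cayley hV hz ((M V (z : OnePoint ℂ)).orthogonalProjectionOnto x) +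
    (C ((M V (z : OnePoint ℂ))ᗮ.orthogonalProjectionOnto x) : H) = _
  rw [Submodule.orthogonalProjectionOnto_mem_subspace_eq_self,
    Submodule.orthogonalProjectionOnto_orthogonal_apply_eq_zero x.2]
  have h : C (0 : (M V (z : OnePoint ℂ))ᗮ) = 0 := C.map_zero
  rw [h, Submodule.coe_zero, add_zero]

lemma plus_apply_sub (f : V.domain) :
    plus hV hz C ((f : H) - z • V f) = V f - conj z • (f : H) := by
  rw [← cayley_apply hV hz f]
  exact plus_apply_M hV hz C ⟨_, _⟩

lemma plus_apply_N (n : N V (z : OnePoint ℂ)) : plus hV hz C n = C n := by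
  have := hasOrthogonalProjection_M hV hz
  change cayley hV hz ((M V (z : OnePoint ℂ)).orthogonalProjectionOnto n) +
    (C ((N V (z : OnePoint ℂ)).orthogonalProjectionOnto n) : H) = _
  rw [Submodule.orthogonalProjectionOnto_eq_zero_iff.2 n.2,
    Submodule.orthogonalProjectionOnto_mem_subspace_eq_self, map_zero, zero_add]

lemma plus_mem_M {F : H} (hF : F ∈ M V (z : OnePoint ℂ)) : plus hV hz C F ∈ M V (invConj z) := by
  obtain ⟨f, rfl⟩ := mem_M_coe.1 hF
  rw [plus_apply_sub]
  exact mem_M_invConj.2 ⟨f, rfl⟩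

lemma plus_mem_N {n : H} (hn : n ∈ N V (z : OnePoint ℂ)) : plus hV hz C n ∈ N V (invConj z) := by
  rw [plus_apply_N hV hz C ⟨n, hn⟩]
  exact (C _).2

lemma exists_plus_eq {y : H} (hy : y ∈ M V (invConj z)) :
    ∃ F ∈ M V (z : OnePoint ℂ), plus hV hz C F = y := by
  obtain ⟨f, rfl⟩ := mem_M_invConj.1 hy
  exact ⟨_, mem_M_coe.2 ⟨f, rfl⟩, plus_apply_sub hV hz C f⟩

lemma inner_plus_plus {F G : H} (hF : F ∈ M V (z : OnePoint ℂ)) (hG : G ∈ M V (z : OnePoint ℂ)) :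
    inner ℂ (plus hV hz C F) (plus hV hz C G) = inner ℂ F G := by
  rw [plus_apply_M hV hz C ⟨F, hF⟩, plus_apply_M hV hz C ⟨G, hG⟩]
  exact (cayley hV hz).inner_map_map _ _

lemma norm_plus {F : H} (hF : F ∈ M V (z : OnePoint ℂ)) : ‖plus hV hz C F‖ = ‖F‖ := by
  rw [plus_apply_M hV hz C ⟨F, hF⟩]
  exact (cayley hV hz).norm_map _

lemma norm_plus_add_sq {F n : H} (hF : F ∈ M V (z : OnePoint ℂ)) (hn : n ∈ N V (z : OnePoint ℂ)) :
    ‖plus hV hz C (F + n)‖ ^ 2 = ‖F‖ ^ 2 + ‖C ⟨n, hn⟩‖ ^ 2 := by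
  rw [map_add, sq, norm_add_sq_eq_norm_sq_add_norm_sq_of_inner_eq_zero _ _ (inner_eq_zero_of_mem
    (plus_mem_M hV hz C hF) (plus_mem_N hV hz C hn)), norm_plus hV hz C hF,
    plus_apply_N hV hz C ⟨n, hn⟩, Submodule.coe_norm, sq, sq]

lemma norm_plus_le_one (hC : ‖C‖ ≤ 1) : ‖plus hV hz C‖ ≤ 1 := by
  refine ContinuousLinearMap.opNorm_le_bound _ zero_le_one fun x => ?_
  obtain ⟨F, hF, n, hn, rfl⟩ := exists_eq_add hV hz x
  rw [one_mul]
  refine le_of_sq_le_sq ?_ (norm_nonneg _)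
  rw [norm_plus_add_sq hV hz C hF hn, norm_add_sq_of_mem hF hn]
  have h : ‖C ⟨n, hn⟩‖ ≤ ‖n‖ := C.le_of_opNorm_le hC ⟨n, hn⟩ |>.trans_eq (one_mul _)
  gcongr

lemma continuous_plus : Continuous (plus hV hz) := by
  have := hasOrthogonalProjection_M hV hz
  unfold plus
  fun_prop

/-- The compression of `plus hV hz C` to `N_z` is `C`. -/
lemma compression_plus :
    (N V (invConj z)).orthogonalProjectionOnto ∘L plus hV hz C ∘L (N V (z : OnePoint ℂ)).subtypeL
      = C := by
  ext n
  simp only [ContinuousLinearMap.comp_apply, Submodule.subtypeL_apply]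
  rw [plus_apply_N, Submodule.orthogonalProjectionOnto_mem_subspace_eq_self]

/-- `V⁺_{z;C}` is unitary if and only if `C` is isometric and onto. -/
lemma plus_mem_unitary_iff :
    plus hV hz C ∈ unitary (H →L[ℂ] H) ↔ Isometry C ∧ Function.Surjective C := by
  constructor
  · intro h
    refine ⟨AddMonoidHomClass.isometry_of_norm _ fun n => ?_, fun y => ?_⟩
    · have := ContinuousLinearMap.norm_map_of_mem_unitary h (n : H)
      rwa [plus_apply_N] at this
    · obtain ⟨F, hF, n, hn, hx⟩ := exists_eq_add hV hz (star (plus hV hz C) y)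
      have hy : plus hV hz C (F + n) = y := by
        rw [← hx]
        exact congr($(Unitary.mul_star_self_of_mem h) (y : H))
      refine ⟨⟨n, hn⟩, Subtype.ext ?_⟩
      rw [map_add] at hy
      -- `V⁺ F = y - C n` lies both in `M_{1 / conj z}` and in its orthogonal complement.
      have h0 : plus hV hz C F = 0 := eq_zero_of_mem_of_mem (plus_mem_M hV hz C hF) (by
        rw [eq_sub_of_add_eq hy]
        exact sub_mem y.2 (plus_mem_N hV hz C hn))
      rw [← plus_apply_N hV hz C ⟨n, hn⟩, ← hy, h0, zero_add]
  · rintro ⟨hi, hs⟩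
    have hnorm : ∀ x, ‖plus hV hz C x‖ = ‖x‖ := by
      intro x
      obtain ⟨F, hF, n, hn, rfl⟩ := exists_eq_add hV hz x
      rw [← sq_eq_sq₀ (norm_nonneg _) (norm_nonneg _), norm_plus_add_sq hV hz C hF hn,
        norm_add_sq_of_mem hF hn, (AddMonoidHomClass.isometry_iff_norm C).1 hi]
      rfl
    have h1 : star (plus hV hz C) * plus hV hz C = 1 :=
      (ContinuousLinearMap.norm_map_iff_adjoint_comp_self _).1 hnorm
    -- Isometry alone gives `T⋆ T = 1`; for `T T⋆ = 1` each vector is written as a value `T x`,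
    -- using that `C` is onto.
    refine Unitary.mem_iff.2 ⟨h1, ?_⟩
    ext y
    have hy : ∃ x, plus hV hz C x = y := by
      obtain ⟨G, hG, n, hn, rfl⟩ := exists_eq_add_invConj hV hz y
      obtain ⟨F, -, rfl⟩ := exists_plus_eq hV hz C hG
      obtain ⟨m, hm⟩ := hs ⟨n, hn⟩
      refine ⟨F + m, ?_⟩
      rw [map_add, plus_apply_N, hm]
    obtain ⟨x, rfl⟩ := hy
    exact congr(plus hV hz C ($h1 x))

end plus

/-! ### The pencil, its resolvent and Inin's formula -/

section pencil

variable {H : Type*} [NormedAddCommGroup H] [InnerProductSpace ℂ H]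

/-- The operator `(1 - conj z lam) E - (lam - z) T`. -/
def pencil (z lam : ℂ) (T : H →L[ℂ] H) : H →L[ℂ] H :=
  (1 - conj z * lam) • (1 : H →L[ℂ] H) - (lam - z) • T

/-- The operator `(E + z T) ((1 - conj z lam) E - (lam - z) T)⁻¹`. -/
def pencilResolvent (z lam : ℂ) (T : H →L[ℂ] H) : H →L[ℂ] H :=
  (1 + z • T) * Ring.inverse (pencil z lam T)

lemma pencil_apply (z lam : ℂ) (T : H →L[ℂ] H) (x : H) :
    pencil z lam T x = (1 - conj z * lam) • x - (lam - z) • T x := rfl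

lemma commute_pencil (z lam : ℂ) (T : H →L[ℂ] H) : Commute (1 + z • T) (pencil z lam T) := by
  have h : Commute (1 + z • T) T := (Commute.one_left T).add_left ((Commute.refl T).smul_left z)
  exact ((Commute.one_right _).smul_right _).sub_right (h.smul_right _)

/-- This compares the two coefficients of the pencil: their quotient has modulus below `1` in the
disc and equal to `1` on the circle. -/
lemma norm_sub_sq_add (z lam : ℂ) :
    ‖lam - z‖ ^ 2 + (1 - ‖z‖ ^ 2) * (1 - ‖lam‖ ^ 2) = ‖1 - conj z * lam‖ ^ 2 := by
  simp only [Complex.sq_norm, normSq_apply, sub_re, sub_im, mul_re, mul_im, conj_re, conj_im,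
    one_re, one_im]
  ring

lemma one_sub_conj_mul_ne_zero {z lam : ℂ} (hz : ‖z‖ < 1) (hlam : ‖lam‖ ≤ 1) :
    1 - conj z * lam ≠ 0 := by
  intro h
  have h1 : ‖conj z * lam‖ = 1 := by rw [← sub_eq_zero.1 h, norm_one]
  rw [norm_mul, RCLike.norm_conj] at h1
  nlinarith [norm_nonneg z, norm_nonneg lam]

lemma sub_ne_zero_of_norm_eq_one {z lam : ℂ} (hz : ‖z‖ < 1) (hlam : ‖lam‖ = 1) : lam - z ≠ 0 := by
  intro h
  rw [sub_eq_zero.1 h] at hlam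
  linarith

lemma one_sub_mul_conj_ne_zero {z : ℂ} (hz : ‖z‖ < 1) : 1 - z * conj z ≠ 0 := by
  have := one_sub_conj_mul_ne_zero hz hz.le
  rwa [mul_comm] at this

lemma norm_one_sub_conj_mul {z lam : ℂ} (hlam : ‖lam‖ = 1) : ‖1 - conj z * lam‖ = ‖lam - z‖ := by
  rw [← sq_eq_sq₀ (norm_nonneg _) (norm_nonneg _), ← norm_sub_sq_add, hlam]
  ring

/-- The inverse pencil is affine in the resolvent, because `(lam - z) (1 + z T) + z A` is a scalar.
This is how `T` is recovered from `R`. -/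
lemma smul_pencilResolvent {z lam : ℂ} {T : H →L[ℂ] H} (h : IsUnit (pencil z lam T)) :
    (lam - z) • pencilResolvent z lam T + z • 1 =
      (lam * (1 - z * conj z)) • Ring.inverse (pencil z lam T) := by
  have h1 : (lam - z) • (1 + z • T) + z • pencil z lam T =
      (lam * (1 - z * conj z)) • (1 : H →L[ℂ] H) := by
    rw [pencil]
    module
  have h2 := congr($h1 * Ring.inverse (pencil z lam T))
  rwa [add_mul, smul_mul_assoc, smul_mul_assoc, smul_mul_assoc, one_mul,
    Ring.mul_inverse_cancel _ h] at h2

/-- The two sides differ by a multiple of `1 - l l'`. The scalars `z'`, `l'` stand for conjugates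
and `S` for an adjoint; keeping them independent lets one identity yield both defects, `1 - T⋆ T`
and `1 - T T⋆`. -/
lemma reflection_identity {A : Type*} [Ring A] [Algebra ℂ A] {z z' l l' : ℂ} (hl : l * l' = 1)
    (S T : A) :
    ((1 - z * l') • 1 - (l' - z') • S) * (1 + z • T) +
      (1 + z' • S) * ((1 - z' * l) • 1 - (l - z) • T) -
      ((1 - z * l') • 1 - (l' - z') • S) * ((1 - z' * l) • 1 - (l - z) • T) =
    (1 - z * z') • (1 - S * T) := by
  have h : ((1 - z * l') • 1 - (l' - z') • S) * (1 + z • T) +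
      (1 + z' • S) * ((1 - z' * l) • 1 - (l - z) • T) -
      ((1 - z * l') • 1 - (l' - z') • S) * ((1 - z' * l) • 1 - (l - z) • T) =
    (1 - z * z') • (1 - S * T) +
      (1 - l * l') • ((z * z') • 1 + z • T + z' • S + S * T) := by
    simp only [sub_mul, mul_sub, add_mul, mul_add, one_mul, mul_one,
      smul_mul_assoc, mul_smul_comm]
    module
  rw [h, hl, sub_self, zero_smul, add_zero]

variable [CompleteSpace H]

lemma isUnit_one_sub_smul {T : H →L[ℂ] H} (hT : ‖T‖ ≤ 1) {c : ℂ} (hc : ‖c‖ < 1) :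
    IsUnit (1 - c • T) := by
  refine isUnit_one_sub_of_norm_lt_one ?_
  rw [norm_smul]
  nlinarith [norm_nonneg c, norm_nonneg T]

lemma isUnit_pencil {z lam : ℂ} (hz : ‖z‖ < 1) (hlam : ‖lam‖ < 1) {T : H →L[ℂ] H}
    (hT : ‖T‖ ≤ 1) : IsUnit (pencil z lam T) := by
  have ha := one_sub_conj_mul_ne_zero hz hlam.le
  have h : pencil z lam T =
      (1 - conj z * lam) • (1 - ((lam - z) / (1 - conj z * lam)) • T) := by
    rw [pencil, smul_sub, smul_smul, mul_div_cancel₀ _ ha]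
  rw [h]
  refine (isUnit_smul_iff (Units.mk0 _ ha) _).2 (isUnit_one_sub_smul hT ?_)
  rw [norm_div, div_lt_one (norm_pos_iff.2 ha), ← sq_lt_sq₀ (norm_nonneg _) (norm_nonneg _),
    ← norm_sub_sq_add]
  have h1 : 0 < 1 - ‖z‖ ^ 2 := by nlinarith [norm_nonneg z]
  have h2 : 0 < 1 - ‖lam‖ ^ 2 := by nlinarith [norm_nonneg lam]
  linarith [mul_pos h1 h2]

lemma star_pencil (z lam : ℂ) (T : H →L[ℂ] H) :
    star (pencil z lam T) = (1 - z * conj lam) • 1 - (conj lam - conj z) • star T := by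
  simp [pencil, star_sub, star_smul]

lemma star_one_add_smul (z : ℂ) (T : H →L[ℂ] H) : star (1 + z • T) = 1 + conj z • star T := by
  simp [star_smul]

/-- For `|lam| = 1`, unitarity of `T` is the relation `R + R⋆ = 1` for
`R = pencilResolvent z lam T`. -/
lemma pencilResolvent_add_star_iff {z lam : ℂ} (hz : ‖z‖ < 1) (hlam : ‖lam‖ = 1) {T : H →L[ℂ] H}
    (h : IsUnit (pencil z lam T)) :
    pencilResolvent z lam T + star (pencilResolvent z lam T) = 1 ↔ T ∈ unitary (H →L[ℂ] H) := by
  set A := pencil z lam T with hA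
  set B := 1 + z • T with hB
  have hc := one_sub_mul_conj_ne_zero hz
  have hll : lam * conj lam = 1 := by rw [mul_conj', hlam]; simp
  have hAB : Commute B A := commute_pencil z lam T
  have hR : pencilResolvent z lam T = B * Ring.inverse A := rfl
  have hsA : IsUnit (star A) := h.star
  -- `R` is needed with `A⁻¹` on either side: `A⋆ (R + R⋆ - 1) A` produces the defect `1 - T⋆ T`,
  -- and `A (R + R⋆ - 1) A⋆` produces `1 - T T⋆`.
  have hR' : pencilResolvent z lam T = Ring.inverse A * B := by
    rw [hR, eq_comm, Ring.inverse_mul_eq_iff_eq_mul _ _ _ h, ← mul_assoc, ← hAB.eq, mul_assoc,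
      Ring.mul_inverse_cancel _ h, mul_one]
  have e1 : star A * B + star B * A - star A * A = (1 - z * conj z) • (1 - star T * T) := by
    rw [hA, star_pencil, hB, star_one_add_smul]
    exact reflection_identity hll _ _
  have e2 : A * star B + B * star A - A * star A = (1 - z * conj z) • (1 - T * star T) := by
    rw [hA, star_pencil, hB, star_one_add_smul, mul_comm z (conj z)]
    exact reflection_identity (by rwa [mul_comm]) _ _
  have f1 : star A * (pencilResolvent z lam T + star (pencilResolvent z lam T) - 1) * A =
      star A * B + star B * A - star A * A := by
    rw [hR, star_mul, ← Ring.inverse_star]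
    simp only [mul_sub, mul_add, sub_mul, add_mul, mul_one]
    rw [← mul_assoc (star A) B, Ring.inverse_mul_cancel_right _ _ h,
      Ring.mul_inverse_cancel_left _ _ hsA]
  have f2 : A * (pencilResolvent z lam T + star (pencilResolvent z lam T) - 1) * star A =
      A * star B + B * star A - A * star A := by
    rw [hR', star_mul, ← Ring.inverse_star]
    simp only [mul_sub, mul_add, sub_mul, add_mul, mul_one]
    rw [← mul_assoc A (star B), Ring.inverse_mul_cancel_right _ _ hsA,
      Ring.mul_inverse_cancel_left _ _ h, add_comm (A * star B)]
  rw [Unitary.mem_iff]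
  constructor
  · intro hs
    rw [hs, sub_self, mul_zero, zero_mul] at f1 f2
    rw [← f1, eq_comm, smul_eq_zero_iff_right hc, sub_eq_zero] at e1
    rw [← f2, eq_comm, smul_eq_zero_iff_right hc, sub_eq_zero] at e2
    exact ⟨e1.symm, e2.symm⟩
  · rintro ⟨h1, -⟩
    rw [e1, h1, sub_self, smul_zero, h.mul_left_eq_zero, hsA.mul_right_eq_zero] at f1
    exact sub_eq_zero.1 f1

/-- Inin's formula in terms of `V⁺_{z;C}`. -/
lemma inverse_one_sub_smul_orthogonalExtension {V : H →ₗ.[ℂ] H} (hV : IsClosedIsometric V) {z : ℂ}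
    (hz : ‖z‖ < 1) {C : N V (z : OnePoint ℂ) →L[ℂ] N V (invConj z)} (hC : ‖C‖ ≤ 1) {lam : ℂ}
    (hlam : ‖lam‖ < 1) :
    Ring.inverse (1 - lam • orthogonalExtension hV hz C) =
      pencilResolvent z lam (plus hV hz C) := by
  have hT := norm_plus_le_one hV hz C hC
  set T := plus hV hz C with hTdef
  have hu : IsUnit (1 + z • T) := by
    have := isUnit_one_sub_smul hT (c := -z) (by rwa [norm_neg])
    rwa [neg_smul, sub_neg_eq_add] at this
  have h1 : 1 - lam • orthogonalExtension hV hz C =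
      pencil z lam T * Ring.inverse (1 + z • T) := by
    rw [Ring.eq_mul_inverse_iff_mul_eq _ _ _ hu, orthogonalExtension, ← hTdef, sub_mul,
      one_mul, smul_mul_assoc, Ring.inverse_mul_cancel_right _ _ hu, pencil]
    module
  rw [h1, Ring.inverse_mul (Or.inl (isUnit_pencil hz hlam hT)), Ring.inverse_inverse hu]
  rfl

end pencil

/-! ### Generalized resolvents: analyticity and reflection in the circle -/

section generalizedResolvent

variable {K : Type*} [NormedAddCommGroup K] [InnerProductSpace ℂ K] [CompleteSpace K]

lemma norm_unitary_le_one (U : unitary (K →L[ℂ] K)) : ‖(U : K →L[ℂ] K)‖ ≤ 1 :=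
  ContinuousLinearMap.opNorm_le_bound _ zero_le_one fun x => by
    rw [ContinuousLinearMap.norm_map_of_mem_unitary U.2, one_mul]

lemma isUnit_one_sub_smul_unitary (U : unitary (K →L[ℂ] K)) {z : ℂ} (hz : ‖z‖ ≠ 1) :
    IsUnit (1 - z • (U : K →L[ℂ] K)) := by
  rcases lt_or_gt_of_ne hz with h | h
  · exact isUnit_one_sub_smul (norm_unitary_le_one U) h
  · have hz0 : z ≠ 0 := norm_pos_iff.1 (zero_lt_one.trans h)
    -- Outside the disc, `1 - z U = -z U (1 - z⁻¹ U⋆)` reduces to a Neumann series.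
    have h1 : 1 - z • (U : K →L[ℂ] K) =
        ((-z) • (U : K →L[ℂ] K)) * (1 - z⁻¹ • ((star U : unitary (K →L[ℂ] K)) : K →L[ℂ] K)) := by
      rw [mul_sub, mul_one, smul_mul_smul_comm, Unitary.coe_mul_star_self,
        neg_mul, mul_inv_cancel₀ hz0]
      module
    rw [h1]
    refine IsUnit.mul ?_ (isUnit_one_sub_smul (norm_unitary_le_one _) ?_)
    · exact (isUnit_smul_iff (Units.mk0 _ (neg_ne_zero.2 hz0)) _).2 (Unitary.toUnits U).isUnit
    · rw [norm_inv]
      exact inv_lt_one_of_one_lt₀ h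

/-- With `X = (1 - z U)⋆` and `Y = 1 - (conj z)⁻¹ U`, unitarity gives `X Y = X + Y`, that is, `X⁻¹ +
Y⁻¹ = 1`. -/
lemma star_inverse_one_sub_smul_unitary (U : unitary (K →L[ℂ] K)) {z : ℂ} (hz0 : z ≠ 0)
    (hz : ‖z‖ ≠ 1) :
    star (Ring.inverse (1 - z • (U : K →L[ℂ] K))) =
      1 - Ring.inverse (1 - (conj z)⁻¹ • (U : K →L[ℂ] K)) := by
  have hz' : ‖(conj z)⁻¹‖ ≠ 1 := by simpa using hz
  have hX := (isUnit_one_sub_smul_unitary U hz).star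
  have hY := isUnit_one_sub_smul_unitary U hz'
  rw [← Ring.inverse_star]
  set X := star (1 - z • (U : K →L[ℂ] K)) with hXdef
  set Y := 1 - (conj z)⁻¹ • (U : K →L[ℂ] K) with hYdef
  have hc0 : conj z ≠ 0 := by simpa using hz0
  have hXY : X * Y = X + Y := by
    rw [hXdef, hYdef, star_sub, star_one, star_smul, sub_mul, one_mul, mul_sub, mul_one,
      smul_mul_smul_comm, Unitary.coe_star_mul_self]
    simp only [RCLike.star_def, mul_inv_cancel₀ hc0]
    module
  have h1 : (1 - Ring.inverse Y) * Y = Y - 1 := by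
    rw [sub_mul, one_mul, Ring.inverse_mul_cancel _ hY]
  have h2 : Ring.inverse X * Y = Y - 1 := by
    rw [Ring.inverse_mul_eq_iff_eq_mul _ _ _ hX, mul_sub, mul_one, hXY, add_sub_cancel_left]
  exact hY.mul_right_cancel (h2.trans h1.symm)

lemma differentiableAt_inverse_one_sub_smul {T : K →L[ℂ] K} {z : ℂ} (h : IsUnit (1 - z • T)) :
    DifferentiableAt ℂ (fun w : ℂ => Ring.inverse (1 - w • T)) z := by
  have h1 : DifferentiableAt ℂ (fun w : ℂ => 1 - w • T) z :=
    (differentiableAt_const _).sub (differentiableAt_id.smul_const _)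
  exact DifferentiableAt.inverse h1 h

variable {H : Type*} [NormedAddCommGroup H] [InnerProductSpace ℂ H] [CompleteSpace H]
  {V : H →ₗ.[ℂ] H} {R : ℂ → H →L[ℂ] H}

/-- Compression to `H` respects adjoints and sends `1` to `1`, so the reflection law descends from
`K`. -/
lemma IsGeneralizedResolvent.star_eq (hR : IsGeneralizedResolvent V R) {z : ℂ} (hz0 : z ≠ 0)
    (hz : ‖z‖ ≠ 1) : star (R z) = 1 - R (conj z)⁻¹ := by
  obtain ⟨K, _, _, _, J, U, -, h⟩ := hR
  have hz' : ‖(conj z)⁻¹‖ ≠ 1 := by simpa using hz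
  have hJ : J.toContinuousLinearMap.adjoint ∘L J.toContinuousLinearMap =
      ContinuousLinearMap.id ℂ H :=
    (ContinuousLinearMap.norm_map_iff_adjoint_comp_self _).1 J.norm_map
  have hs := star_inverse_one_sub_smul_unitary U hz0 hz
  rw [ContinuousLinearMap.star_eq_adjoint] at hs ⊢
  rw [h z hz, h _ hz', ContinuousLinearMap.adjoint_comp, ContinuousLinearMap.adjoint_comp,
    ContinuousLinearMap.adjoint_adjoint, hs, ContinuousLinearMap.comp_assoc,
    ContinuousLinearMap.sub_comp, ContinuousLinearMap.comp_sub, ContinuousLinearMap.one_def,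
    ContinuousLinearMap.id_comp, hJ, ContinuousLinearMap.one_def]

lemma IsGeneralizedResolvent.analyticAt (hR : IsGeneralizedResolvent V R) {z : ℂ}
    (hz : ‖z‖ ≠ 1) : AnalyticAt ℂ R z := by
  obtain ⟨K, _, _, _, J, U, -, h⟩ := hR
  have hopen : IsOpen {z : ℂ | ‖z‖ ≠ 1} := isOpen_ne_fun continuous_norm continuous_const
  have hd : DifferentiableOn ℂ R {z : ℂ | ‖z‖ ≠ 1} := by
    refine DifferentiableOn.congr (fun w hw => DifferentiableAt.differentiableWithinAt ?_) h
    exact (differentiableAt_const _).clm_comp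
      ((differentiableAt_inverse_one_sub_smul (isUnit_one_sub_smul_unitary U hw)).clm_comp
        (differentiableAt_const _))
  exact hd.analyticAt (hopen.mem_nhds hz)

end generalizedResolvent

/-! ### Invertibility of the pencil at a point of the circle -/

section boundary

variable {H : Type*} [NormedAddCommGroup H] [InnerProductSpace ℂ H] [CompleteSpace H]
  {V : H →ₗ.[ℂ] H} (hV : IsClosedIsometric V) {z : ℂ} (hz : ‖z‖ < 1)
  (C : N V (z : OnePoint ℂ) →L[ℂ] N V (invConj z)) {lam : ℂ}

lemma starProjection_N_eq_zero {ζ : OnePoint ℂ} {F : H} (hF : F ∈ M V ζ) :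
    (N V ζ).starProjection F = 0 :=
  (Submodule.starProjection_apply_eq_zero_iff _).2 (Submodule.le_orthogonal_orthogonal _ hF)

/-- On `M_z` the pencil does not see `C`, and up to a nonzero scalar it is the natural map from
`M_z` onto `M_lam`. -/
lemma pencil_plus_sub (f : V.domain) :
    pencil z lam (plus hV hz C) ((f : H) - z • V f) =
      (1 - z * conj z) • ((f : H) - lam • V f) := by
  rw [pencil_apply, plus_apply_sub]
  module

lemma pencil_plus_mem_M {G : H} (hG : G ∈ M V (z : OnePoint ℂ)) :
    pencil z lam (plus hV hz C) G ∈ M V (lam : OnePoint ℂ) := by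
  obtain ⟨f, rfl⟩ := mem_M_coe.1 hG
  rw [pencil_plus_sub]
  exact Submodule.smul_mem _ _ (mem_M_coe.2 ⟨f, rfl⟩)

lemma conj_mul_self_one_sub {z : ℂ} (hlam : ‖lam‖ = 1) :
    (1 - conj z * lam) * conj (1 - conj z * lam) = (lam - z) * conj (lam - z) := by
  rw [mul_conj', mul_conj', norm_one_sub_conj_mul hlam]

/-- On `N_lam` the pencil acts as a combination of `P_{N_{1 / conj z}}` and `C`. -/
lemma pencil_plus_of_mem_N (hlam : ‖lam‖ = 1) {F n : H} (hF : F ∈ M V (z : OnePoint ℂ))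
    (hn : n ∈ N V (z : OnePoint ℂ)) (hf : F + n ∈ N V (lam : OnePoint ℂ)) :
    pencil z lam (plus hV hz C) (F + n) =
      (1 - conj z * lam) • (N V (invConj z)).starProjection (F + n) -
        (lam - z) • (C ⟨n, hn⟩ : H) := by
  have hab := conj_mul_self_one_sub (z := z) hlam
  have hb : conj (lam - z) ≠ 0 := by
    rw [Ne, map_eq_zero]
    exact sub_ne_zero_of_norm_eq_one hz hlam
  -- Write `a`, `b` for the coefficients of the pencil. Testing `F + n ⊥ M_lam` against pencil
  -- values at `G ∈ M_z` and using `|a| = |b|` gives orthogonality to every `V_z G`, hence to `M_{1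
  -- / conj z}`.
  have hmem : (1 - conj z * lam) • (F + n) - (lam - z) • plus hV hz C F ∈ N V (invConj z) := by
    refine (Submodule.mem_orthogonal _ _).2 fun y hy => ?_
    obtain ⟨G, hG, rfl⟩ := exists_plus_eq hV hz C hy
    have h1 := inner_eq_zero_of_mem (pencil_plus_mem_M hV hz C (lam := lam) hG) hf
    rw [pencil_apply, inner_sub_left, inner_smul_left, inner_smul_left] at h1
    have h2 : inner ℂ G (F + n) = inner ℂ G F := by
      rw [inner_add_right, inner_eq_zero_of_mem hG hn, add_zero]
    rw [inner_sub_right, inner_smul_right, inner_smul_right, inner_plus_plus hV hz C hG hF, ← h2]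
    refine (mul_eq_zero.1 ?_).resolve_left hb
    linear_combination (-(1 - conj z * lam)) * h1 + inner ℂ G (F + n) * hab
  have hproj := Submodule.starProjection_eq_self_iff.2 hmem
  rw [map_sub, map_smul, map_smul, starProjection_N_eq_zero (plus_mem_M hV hz C hF),
    smul_zero, sub_zero] at hproj
  rw [hproj, pencil_apply, map_add, plus_apply_N hV hz C ⟨n, hn⟩]
  module

/-- Surjectivity of the pencil from `M_z` to `M_{1 / conj z}`, modulo `N_{1 / conj z}`. -/
lemma exists_pencil_sub_mem
    (hrange : (M V (lam : OnePoint ℂ)).map (proj (M V (invConj z)) : H →ₗ[ℂ] H) =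
      M V (invConj z)) {y : H} (hy : y ∈ M V (invConj z)) :
    ∃ F ∈ M V (z : OnePoint ℂ), pencil z lam (plus hV hz C) F - y ∈ N V (invConj z) := by
  rw [← hrange] at hy
  obtain ⟨x, hx, rfl⟩ := hy
  obtain ⟨f, rfl⟩ := mem_M_coe.1 hx
  refine ⟨(1 - z * conj z)⁻¹ • ((f : H) - z • V f),
    Submodule.smul_mem _ _ (mem_M_coe.2 ⟨f, rfl⟩), ?_⟩
  rw [map_smul, pencil_plus_sub, inv_smul_smul₀ (one_sub_mul_conj_ne_zero hz)]
  exact Submodule.orthogonal_le (Submodule.le_topologicalClosure _)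
    (Submodule.sub_starProjection_mem_orthogonal _)

/-- `P_{N_z} N_lam = N_z`. -/
lemma exists_add_mem_N (hV : IsClosedIsometric V) (hz : ‖z‖ < 1) (hlam : ‖lam‖ = 1)
    (hrange : (M V (lam : OnePoint ℂ)).map (proj (M V (invConj z)) : H →ₗ[ℂ] H) =
      M V (invConj z)) {n : H} (hn : n ∈ N V (z : OnePoint ℂ)) :
    ∃ F ∈ M V (z : OnePoint ℂ), F + n ∈ N V (lam : OnePoint ℂ) := by
  have hab := conj_mul_self_one_sub (z := z) hlam
  obtain ⟨p, hp, q, hq, hpq⟩ := exists_eq_add_invConj hV hz n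
  -- `F` is chosen to cancel the `M_{1 / conj z}`-component of `(1 - conj z lam) n`. The parameter
  -- `0` is an arbitrary choice of `C`, which plays no role on `M_z`.
  obtain ⟨F, hF, hFN⟩ := exists_pencil_sub_mem hV hz 0 hrange
    (Submodule.smul_mem _ (-(1 - conj z * lam)) hp)
  have hmem : (1 - conj z * lam) • (F + n) - (lam - z) • plus hV hz 0 F ∈ N V (invConj z) := by
    have := add_mem hFN (Submodule.smul_mem _ (1 - conj z * lam) hq)
    rw [pencil_apply] at this
    convert this using 1
    rw [hpq]
    module
  refine ⟨F, hF, (Submodule.mem_orthogonal _ _).2 fun y hy => ?_⟩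
  obtain ⟨f, rfl⟩ := mem_M_coe.1 hy
  set G := (f : H) - z • V f with hGdef
  have hG : G ∈ M V (z : OnePoint ℂ) := mem_M_coe.2 ⟨f, rfl⟩
  have hGf : (f : H) - lam • V f = (1 - z * conj z)⁻¹ • pencil z lam (plus hV hz 0) G := by
    rw [hGdef, pencil_plus_sub, inv_smul_smul₀ (one_sub_mul_conj_ne_zero hz)]
  have h1 := inner_eq_zero_of_mem (plus_mem_M hV hz 0 hG) hmem
  have h2 : inner ℂ G (F + n) = inner ℂ G F := by
    rw [inner_add_right, inner_eq_zero_of_mem hG hn, add_zero]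
  rw [inner_sub_right, inner_smul_right, inner_smul_right, inner_plus_plus hV hz 0 hG hF,
    ← h2] at h1
  rw [hGf, inner_smul_left, pencil_apply, inner_sub_left, inner_smul_left, inner_smul_left]
  refine mul_eq_zero_of_right _
    ((mul_eq_zero.1 ?_).resolve_left (one_sub_conj_mul_ne_zero hz hlam.le))
  linear_combination (-conj (lam - z)) * h1 + inner ℂ G (F + n) * hab

/-- Split `F = p + q` along `M_{1 / conj z}` and `N_{1 / conj z}`. The `M`-component of the pencil
value vanishes, so `(1 - conj z lam) p = (lam - z) V_z F`; taking norms gives `‖p‖ = ‖F‖`, so `q =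
0`. Then the pencil kills `F`, which means `f = lam V f` for the `f` generating `F`, and regular
type forces `f = 0`. -/
lemma eq_zero_of_pencil_mem_N (hlam : ‖lam‖ = 1) (hreg : IsRegularType V lam⁻¹) {F : H}
    (hF : F ∈ M V (z : OnePoint ℂ))
    (hFN : pencil z lam (plus hV hz C) F ∈ N V (invConj z)) : F = 0 := by
  obtain ⟨p, hp, q, hq, hpq⟩ := exists_eq_add_invConj hV hz F
  have hb := sub_ne_zero_of_norm_eq_one hz hlam
  have hdecomp : pencil z lam (plus hV hz C) F - (1 - conj z * lam) • q =
      (1 - conj z * lam) • p - (lam - z) • plus hV hz C F := by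
    rw [pencil_apply]
    nth_rewrite 1 [hpq]
    module
  have h0 : (1 - conj z * lam) • p - (lam - z) • plus hV hz C F = 0 := by
    refine eq_zero_of_mem_of_mem (ζ := invConj z) (V := V) ?_ ?_
    · exact sub_mem (Submodule.smul_mem _ _ hp) (Submodule.smul_mem _ _ (plus_mem_M hV hz C hF))
    · rw [← hdecomp]
      exact sub_mem hFN (Submodule.smul_mem _ _ hq)
  have hnorm : ‖p‖ = ‖F‖ := by
    have h := congr(‖$(sub_eq_zero.1 h0)‖)
    rw [norm_smul, norm_smul, norm_plus hV hz C hF, norm_one_sub_conj_mul hlam] at h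
    exact mul_left_cancel₀ (norm_ne_zero_iff.2 hb) h
  have hq0 : q = 0 := by
    have h := norm_add_sq_of_mem hp hq
    rw [← hpq, hnorm, left_eq_add] at h
    exact norm_eq_zero.1 (pow_eq_zero_iff two_ne_zero |>.1 h)
  rw [hq0, add_zero] at hpq
  rw [← hpq] at h0
  obtain ⟨f, rfl⟩ := mem_M_coe.1 hF
  rw [← pencil_apply, pencil_plus_sub, smul_eq_zero_iff_right (one_sub_mul_conj_ne_zero hz)] at h0
  obtain ⟨k, hk, hk'⟩ := hreg
  have hlam0 : lam ≠ 0 := norm_ne_zero_iff.1 (by rw [hlam]; exact one_ne_zero)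
  have h1 : V f - lam⁻¹ • (f : H) = 0 := by
    rw [sub_eq_zero.1 h0, inv_smul_smul₀ hlam0, sub_self]
  have h2 := hk' f
  rw [h1, norm_zero] at h2
  have h3 : f = 0 := by
    have : ‖(f : H)‖ ≤ 0 := by
      by_contra hc
      push Not at hc
      nlinarith
    simpa using this
  simp [h3]

lemma W_apply (hV : IsClosedIsometric V) (hz : ‖z‖ < 1) (hlam : ‖lam‖ = 1) {f : H}
    (hf : f ∈ N V (lam : OnePoint ℂ)) :
    ∃ h : (N V (z : OnePoint ℂ)).starProjection f ∈ (W V z lam).domain,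
      W V z lam ⟨_, h⟩ =
        ((1 - conj z * lam) / (lam - z)) • (N V (invConj z)).starProjection f := by
  have hgraph : (W V z lam).graph = WGraph V z lam :=
    Submodule.toLinearPMap_graph_eq _ (WGraph_functional hV hz hlam)
  have hmem : ((N V (z : OnePoint ℂ)).starProjection f,
      ((1 - conj z * lam) / (lam - z)) • (N V (invConj z)).starProjection f) ∈
        (W V z lam).graph := by
    rw [hgraph]
    exact ⟨f, hf, rfl⟩
  obtain ⟨y, hy1, hy2⟩ := (LinearPMap.mem_graph_iff _).1 hmem
  simp only at hy1 hy2
  refine ⟨hy1 ▸ y.2, ?_⟩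
  rw [← hy2]
  congr 1
  exact Subtype.ext hy1.symm

/-- `C - W_{lam;z}` is defined on the whole of `N_z`, and the pencil acts on `N_lam` as
`-(lam - z) (C - W_{lam;z}) P_{N_z}`. -/
lemma exists_pencil_eq (hlam : ‖lam‖ = 1)
    (hrange : (M V (lam : OnePoint ℂ)).map (proj (M V (invConj z)) : H →ₗ[ℂ] H) =
      M V (invConj z)) {n : H} (hn : n ∈ N V (z : OnePoint ℂ)) :
    ∃ h : n ∈ (toPMap C - W V z lam).domain, ∃ F ∈ M V (z : OnePoint ℂ),
      (toPMap C - W V z lam).toFun ⟨n, h⟩ ∈ N V (invConj z) ∧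
      pencil z lam (plus hV hz C) (F + n) =
        -(lam - z) • (toPMap C - W V z lam).toFun ⟨n, h⟩ := by
  obtain ⟨F, hF, hf⟩ := exists_add_mem_N hV hz hlam hrange hn
  have hproj : (N V (z : OnePoint ℂ)).starProjection (F + n) = n := by
    rw [map_add, Submodule.starProjection_eq_self_iff.2 hn,
      starProjection_N_eq_zero hF, zero_add]
  obtain ⟨hW, hWe⟩ := W_apply hV hz hlam hf
  have hW' : n ∈ (W V z lam).domain := by rwa [hproj] at hW
  have hWn : W V z lam ⟨n, hW'⟩ =
      ((1 - conj z * lam) / (lam - z)) • (N V (invConj z)).starProjection (F + n) := by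
    rw [← hWe]
    congr 1
    exact Subtype.ext hproj.symm
  have hsub : (toPMap C - W V z lam).toFun ⟨n, ⟨hn, hW'⟩⟩ = (C ⟨n, hn⟩ : H) -
      ((1 - conj z * lam) / (lam - z)) • (N V (invConj z)).starProjection (F + n) := by
    rw [← hWn]
    exact LinearPMap.sub_apply (toPMap C) (W V z lam) ⟨n, ⟨hn, hW'⟩⟩
  refine ⟨⟨hn, hW'⟩, F, hF, ?_, ?_⟩
  · rw [hsub]
    exact sub_mem (C _).2 (Submodule.smul_mem _ _ (Submodule.starProjection_apply_mem _ _))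
  · rw [hsub, pencil_plus_of_mem_N hV hz C hlam hF hn hf, smul_sub, smul_smul, neg_mul,
      mul_div_cancel₀ _ (sub_ne_zero_of_norm_eq_one hz hlam)]
    module

/-- The boundary criterion for invertibility of the pencil. -/
lemma isUnit_pencil_plus_iff (hlam : ‖lam‖ = 1) (hreg : IsRegularType V lam⁻¹)
    (hrange : (M V (lam : OnePoint ℂ)).map (proj (M V (invConj z)) : H →ₗ[ℂ] H) =
      M V (invConj z)) :
    IsUnit (pencil z lam (plus hV hz C)) ↔
      Function.Injective (toPMap C - W V z lam).toFun ∧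
        LinearMap.range (toPMap C - W V z lam).toFun = N V (invConj z) := by
  have hb := neg_ne_zero.2 (sub_ne_zero_of_norm_eq_one hz hlam)
  have hdom : ∀ u : (toPMap C - W V z lam).domain, (u : H) ∈ N V (z : OnePoint ℂ) := fun u => u.2.1
  rw [ContinuousLinearMap.isUnit_iff_bijective, injective_iff_map_eq_zero]
  constructor
  · rintro ⟨hinj, hsurj⟩
    constructor
    · rintro u hu
      obtain ⟨h, F, hF, -, he⟩ := exists_pencil_eq hV hz C hlam hrange (hdom u)
      rw [show (⟨(u : H), h⟩ : (toPMap C - W V z lam).domain) = u from rfl, hu, smul_zero] at he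
      have h0 := (injective_iff_map_eq_zero _).1 hinj _ he
      refine Subtype.ext (eq_zero_of_mem_of_mem (ζ := (z : OnePoint ℂ)) (V := V) ?_ (hdom u))
      rw [eq_neg_of_add_eq_zero_right h0]
      exact neg_mem hF
    · refine le_antisymm ?_ fun y hy => ?_
      · rintro _ ⟨u, rfl⟩
        obtain ⟨h, F, hF, hN, -⟩ := exists_pencil_eq hV hz C hlam hrange (hdom u)
        exact hN
      · obtain ⟨x, hx⟩ := hsurj (-(lam - z) • y)
        obtain ⟨G, hG, n, hn, rfl⟩ := exists_eq_add hV hz x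
        obtain ⟨h, F, hF, hN, he⟩ := exists_pencil_eq hV hz C hlam hrange hn
        refine ⟨⟨n, h⟩, ?_⟩
        -- `x = G + n` and `F + n` share the component `n`, so their pencil values differ by that of
        -- `G - F ∈ M_z`; here the difference lies in `N_{1 / conj z}`, which forces `G = F`.
        have hGF : pencil z lam (plus hV hz C) (G - F) = -(lam - z) • y -
            -(lam - z) • (toPMap C - W V z lam).toFun ⟨n, h⟩ := by
          rw [← hx, ← he, ← map_sub]
          congr 1
          abel
        have h0 := eq_zero_of_pencil_mem_N hV hz C hlam hreg (sub_mem hG hF) (by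
          rw [hGF]
          exact sub_mem (Submodule.smul_mem _ _ hy) (Submodule.smul_mem _ _ hN))
        rw [h0, map_zero, ← smul_sub, eq_comm, smul_eq_zero_iff_right hb, sub_eq_zero] at hGF
        exact hGF.symm
  · rintro ⟨hinj, hsurj⟩
    constructor
    · refine (injective_iff_map_eq_zero _).2 fun x hx => ?_
      obtain ⟨G, hG, n, hn, rfl⟩ := exists_eq_add hV hz x
      obtain ⟨h, F, hF, hN, he⟩ := exists_pencil_eq hV hz C hlam hrange hn
      have hGF : pencil z lam (plus hV hz C) (G - F) =
          -(-(lam - z) • (toPMap C - W V z lam).toFun ⟨n, h⟩) := by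
        rw [← he, ← zero_sub, ← hx, ← map_sub]
        congr 1
        abel
      have h0 := eq_zero_of_pencil_mem_N hV hz C hlam hreg (sub_mem hG hF) (by
        rw [hGF]
        exact neg_mem (Submodule.smul_mem _ _ hN))
      rw [h0, map_zero, eq_comm, neg_eq_zero, smul_eq_zero_iff_right hb] at hGF
      have hn0 : n = 0 := congr(($(hinj _ hGF) : H))
      subst hn0
      rw [add_zero] at hx ⊢
      exact eq_zero_of_pencil_mem_N hV hz C hlam hreg hG (by rw [hx]; exact zero_mem _)
    · intro y
      obtain ⟨p, hp, q, hq, rfl⟩ := exists_eq_add_invConj hV hz y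
      obtain ⟨F, hF, hFp⟩ := exists_pencil_sub_mem hV hz C hrange hp
      have hr := sub_mem hq hFp
      rw [← hsurj] at hr
      obtain ⟨u, hu⟩ := hr
      obtain ⟨h, G, hG, -, he⟩ := exists_pencil_eq hV hz C hlam hrange (hdom u)
      rw [show (⟨(u : H), h⟩ : (toPMap C - W V z lam).domain) = u from rfl, hu] at he
      -- `F` reproduces `p` up to an error in `N_{1 / conj z}`; that error, together with `q`, is a
      -- value of `C - W` and is attained on `G + u`.
      refine ⟨F + (-(lam - z))⁻¹ • (G + u), ?_⟩
      rw [map_add, map_smul, he, inv_smul_smul₀ hb]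
      abel

end boundary

/-! ### Passage to the boundary in both directions -/

section continuation

/-- `S₀ = S_i (1 - S_i⁻¹ (S_i - S₀))`, and bounded inverses make the second factor a Neumann
perturbation of `1` once `S_i` is close to `S₀`. -/
lemma isUnit_of_tendsto {ι A : Type*} [NormedRing A] [CompleteSpace A] {l : Filter ι} [l.NeBot]
    {S : ι → A} {S₀ : A} (hS : Tendsto S l (𝓝 S₀)) (hu : ∀ᶠ i in l, IsUnit (S i)) {K : ℝ}
    (hK : ∀ᶠ i in l, ‖Ring.inverse (S i)‖ ≤ K) : IsUnit S₀ := by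
  have hlim : Tendsto (fun i => K * ‖S i - S₀‖) l (𝓝 0) := by
    simpa using (tendsto_iff_norm_sub_tendsto_zero.1 hS).const_mul K
  obtain ⟨i, hi, hKi, hlt⟩ := (hu.and (hK.and (hlim.eventually_lt_const one_pos))).exists
  have h : S₀ = S i * (1 - Ring.inverse (S i) * (S i - S₀)) := by
    rw [mul_sub, mul_one, Ring.mul_inverse_cancel_left _ _ hi, sub_sub_cancel]
  rw [h]
  refine hi.mul (isUnit_one_sub_of_norm_lt_one ((norm_mul_le _ _).trans_lt ?_))
  exact (mul_le_mul_of_nonneg_right hKi (norm_nonneg _)).trans_lt hlt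

lemma IsOpenArc.norm_eq_one {Δ : Set ℂ} (hΔ : IsOpenArc Δ) {lam : ℂ} (h : lam ∈ Δ) :
    ‖lam‖ = 1 := by
  obtain ⟨a, b, -, rfl⟩ := hΔ
  obtain ⟨t, -, rfl⟩ := h
  exact norm_exp_ofReal_mul_I t

lemma conj_inv_eq_self {lam : ℂ} (h : ‖lam‖ = 1) : (conj lam)⁻¹ = lam :=
  inv_eq_of_mul_eq_one_left (by rw [mul_conj', h]; simp)

lemma mobius_mobius {z lam : ℂ} (hz : ‖z‖ < 1) (hlam : ‖lam‖ ≤ 1) :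
    (z + (lam - z) / (1 - conj z * lam)) / (1 + (lam - z) / (1 - conj z * lam) * conj z) = lam := by
  have ha := one_sub_conj_mul_ne_zero hz hlam
  have h1 : z + (lam - z) / (1 - conj z * lam) =
      lam * (1 - z * conj z) / (1 - conj z * lam) := by
    rw [eq_div_iff ha]
    linear_combination div_mul_cancel₀ (lam - z) ha
  have h2 : 1 + (lam - z) / (1 - conj z * lam) * conj z =
      (1 - z * conj z) / (1 - conj z * lam) := by
    rw [eq_div_iff ha]
    linear_combination conj z * div_mul_cancel₀ (lam - z) ha
  rw [h1, h2, div_div_div_cancel_right₀ ha, mul_div_cancel_right₀ _ (one_sub_mul_conj_ne_zero hz)]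

lemma nhdsWithin_disc_neBot {lam : ℂ} (h : ‖lam‖ = 1) : (𝓝[{z : ℂ | ‖z‖ < 1}] lam).NeBot := by
  rw [← mem_closure_iff_nhdsWithin_neBot]
  have h1 : {z : ℂ | ‖z‖ < 1} = Metric.ball 0 1 := by ext; simp
  rw [h1, closure_ball _ one_ne_zero]
  simp [h]

lemma isOpen_disc : IsOpen {z : ℂ | ‖z‖ < 1} := isOpen_lt continuous_norm continuous_const

variable {H : Type*} [NormedAddCommGroup H] [InnerProductSpace ℂ H] [CompleteSpace H]
  {V : H →ₗ.[ℂ] H} {hV : IsClosedIsometric V} {Δ : Set ℂ}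
  {z₀ : ℂ} {hz₀ : ‖z₀‖ < 1} {R : ℂ → H →L[ℂ] H}
  {C : ℂ → N V (z₀ : OnePoint ℂ) →L[ℂ] N V (invConj z₀)}

lemma norm_pencil_le {z lam : ℂ} (hz : ‖z‖ ≤ 1) (hlam : ‖lam‖ ≤ 1) {T : H →L[ℂ] H}
    (hT : ‖T‖ ≤ 1) : ‖pencil z lam T‖ ≤ 4 := by
  have h1 : ‖1 - conj z * lam‖ ≤ 2 := by
    refine (norm_sub_le _ _).trans ?_
    rw [norm_one, norm_mul, RCLike.norm_conj]
    nlinarith [norm_nonneg z, norm_nonneg lam]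
  have h2 : ‖lam - z‖ ≤ 2 := (norm_sub_le _ _).trans (by linarith)
  have h3 : ‖(1 : H →L[ℂ] H)‖ ≤ 1 := ContinuousLinearMap.norm_id_le
  refine (norm_sub_le _ _).trans ?_
  rw [norm_smul, norm_smul]
  have := mul_le_mul h1 h3 (norm_nonneg _) zero_le_two
  have := mul_le_mul h2 hT (norm_nonneg _) zero_le_two
  linarith

lemma continuousWithinAt_pencilResolvent {z lam : ℂ} {s : Set ℂ} {T : ℂ → H →L[ℂ] H}
    (hT : ContinuousWithinAt T s lam) (hu : IsUnit (pencil z lam (T lam))) :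
    ContinuousWithinAt (fun w => pencilResolvent z w (T w)) s lam := by
  have h1 : ContinuousWithinAt (fun w => pencil z w (T w)) s lam := by
    unfold pencil
    fun_prop
  obtain ⟨u, hu⟩ := hu
  have hi : ContinuousAt Ring.inverse (pencil z lam (T lam)) :=
    hu ▸ NormedRing.inverse_continuousAt u
  have h2 : ContinuousWithinAt (fun w => Ring.inverse (pencil z w (T w))) s lam :=
    hi.comp_continuousWithinAt (f := fun w => pencil z w (T w)) h1
  exact (continuousWithinAt_const.add (hT.const_smul z)).mul h2

lemma CorrespondsTo.norm_plus_le_one (hC : CorrespondsTo hV hz₀ C R) {lam : ℂ} (h : ‖lam‖ < 1) :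
    ‖plus hV hz₀ (C lam)‖ ≤ 1 :=
  IsometricGap.norm_plus_le_one _ _ _ (hC.1.norm_le_one lam (by simpa using h))

lemma CorrespondsTo.isUnit_pencil (hC : CorrespondsTo hV hz₀ C R) {lam : ℂ} (h : ‖lam‖ < 1) :
    IsUnit (pencil z₀ lam (plus hV hz₀ (C lam))) :=
  IsometricGap.isUnit_pencil hz₀ h (hC.norm_plus_le_one h)

lemma CorrespondsTo.eq_pencilResolvent (hC : CorrespondsTo hV hz₀ C R) {lam : ℂ}
    (h : ‖lam‖ < 1) : R lam = pencilResolvent z₀ lam (plus hV hz₀ (C lam)) := by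
  have h' : lam ∈ Metric.ball (0 : ℂ) 1 := by simpa using h
  rw [hC.2 lam h', inverse_one_sub_smul_orthogonalExtension hV hz₀ (hC.1.norm_le_one lam h') h]

/-- A continuous extension of the parameter with unitary boundary values and invertible boundary
pencils gives an analytic continuation of the generalized resolvent. -/
lemma exists_analytic_continuation (hΔ : IsOpenArc Δ) (hR : IsGeneralizedResolvent V R)
    (hC : CorrespondsTo hV hz₀ C R) {C' : ℂ → N V (z₀ : OnePoint ℂ) →L[ℂ] N V (invConj z₀)}
    (hC' : EqOn C' C {z : ℂ | ‖z‖ < 1}) (hcont : ContinuousOn C' ({z : ℂ | ‖z‖ < 1} ∪ Δ))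
    (hunitary : ∀ lam ∈ Δ, plus hV hz₀ (C' lam) ∈ unitary (H →L[ℂ] H))
    (hunit : ∀ lam ∈ Δ, IsUnit (pencil z₀ lam (plus hV hz₀ (C' lam)))) :
    ∃ R' : ℂ → H →L[ℂ] H,
      AnalyticOnNhd ℂ R' ({z : ℂ | ‖z‖ < 1} ∪ {z : ℂ | 1 < ‖z‖} ∪ Δ) ∧
      EqOn R' R ({z : ℂ | ‖z‖ < 1} ∪ {z : ℂ | 1 < ‖z‖}) := by
  set F : ℂ → H →L[ℂ] H := fun w => pencilResolvent z₀ w (plus hV hz₀ (C' w)) with hF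
  have hFc : ContinuousOn F ({z : ℂ | ‖z‖ < 1} ∪ Δ) := by
    intro w hw
    refine continuousWithinAt_pencilResolvent
      ((continuous_plus hV hz₀).continuousAt.comp_continuousWithinAt (hcont w hw)) ?_
    rcases hw with hw | hw
    · rw [hC' hw]
      exact hC.isUnit_pencil hw
    · exact hunit w hw
  have hFR : ∀ w, ‖w‖ < 1 → F w = R w := fun w hw => by
    rw [hC.eq_pencilResolvent hw, ← hC' hw]
  -- Off the circle nothing changes; only the values on the circle come from the extended parameter.
  set R' : ℂ → H →L[ℂ] H := fun w => if ‖w‖ = 1 then F w else R w with hR'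
  have hR'R : ∀ w, ‖w‖ ≠ 1 → R' w = R w := fun w hw => if_neg hw
  have hopen : IsOpen {z : ℂ | ‖z‖ ≠ 1} := isOpen_ne_fun continuous_norm continuous_const
  have hR'an : ∀ w, ‖w‖ ≠ 1 → AnalyticAt ℂ R' w := fun w hw =>
    (hR.analyticAt hw).congr
      (Filter.eventually_of_mem (hopen.mem_nhds hw) fun v hv => (hR'R v hv).symm)
  have hin : EqOn R' F ({z : ℂ | ‖z‖ < 1} ∪ Δ) := by
    rintro w (hw | hw)
    · rw [hR'R w (ne_of_lt hw), hFR w hw]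
    · exact if_pos (hΔ.norm_eq_one hw)
  have hmaps : MapsTo (fun w : ℂ => (conj w)⁻¹) ({z : ℂ | 1 < ‖z‖} ∪ Δ)
      ({z : ℂ | ‖z‖ < 1} ∪ Δ) := by
    rintro w (hw | hw)
    · left
      simpa using inv_lt_one_of_one_lt₀ (show 1 < ‖w‖ from hw)
    · right
      simpa only [conj_inv_eq_self (hΔ.norm_eq_one hw)] using hw
  -- From outside, `R'` is the reflection of `F`. On the arc, which `w ↦ (conj w)⁻¹` fixes
  -- pointwise, the same formula is `R + R⋆ = 1`, supplied by unitarity; so the one-sided limits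
  -- match.
  have hout : EqOn R' (fun w => 1 - star (F (conj w)⁻¹)) ({z : ℂ | 1 < ‖z‖} ∪ Δ) := by
    rintro w (hw | hw)
    · have hw' : 1 < ‖w‖ := hw
      have hw0 : w ≠ 0 := norm_pos_iff.1 (zero_lt_one.trans hw')
      have hlt : ‖(conj w)⁻¹‖ < 1 := by simpa using inv_lt_one_of_one_lt₀ hw'
      have hs := hR.star_eq (z := (conj w)⁻¹) (by simpa using hw0) hlt.ne
      rw [map_inv₀, conj_conj, inv_inv] at hs
      simp only
      rw [hR'R w hw'.ne', hFR _ hlt, hs, sub_sub_cancel]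
    · have hw1 := hΔ.norm_eq_one hw
      have h := (pencilResolvent_add_star_iff hz₀ hw1 (hunit w hw)).2 (hunitary w hw)
      simp only
      rw [conj_inv_eq_self hw1, hin (Or.inr hw)]
      exact eq_sub_of_add_eq h
  refine ⟨R', analyticOnNhd_of_continuousOn_of_off_circle hΔ ?_ hR'an, ?_⟩
  · rintro w (hw | hw)
    · exact (hR'an w (hw.elim (fun h => ne_of_lt h)
        fun h => ne_of_gt h)).continuousAt.continuousWithinAt
    · have h1 : ContinuousWithinAt R' ({z : ℂ | ‖z‖ < 1} ∪ Δ) w :=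
        (hFc.congr hin) w (Or.inr hw)
      have h2 : ContinuousWithinAt R' ({z : ℂ | 1 < ‖z‖} ∪ Δ) w := by
        refine ContinuousOn.congr (continuousOn_const.sub ((hFc.comp ?_ hmaps).star)) hout w
          (Or.inr hw)
        refine (continuous_conj.continuousOn).inv₀ ?_
        rintro v (hv | hv) h0
        · have hv' : 1 < ‖v‖ := hv
          rw [(map_eq_zero _).1 h0, norm_zero] at hv'
          linarith
        · have hv' := hΔ.norm_eq_one hv
          rw [(map_eq_zero _).1 h0, norm_zero] at hv'
          linarith
      refine (h1.union h2).mono ?_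
      rintro v ((hv | hv) | hv)
      · exact Or.inl (Or.inl hv)
      · exact Or.inr (Or.inl hv)
      · exact Or.inl (Or.inr hv)
  · rintro w (hw | hw)
    · exact hR'R w (ne_of_lt hw)
    · exact hR'R w (ne_of_gt hw)

/-- An analytic continuation of the generalized resolvent gives a continuous extension of the
parameter with unitary boundary values and invertible boundary pencils. -/
lemma exists_continuous_extension (hΔ : IsOpenArc Δ) (hR : IsGeneralizedResolvent V R)
    (hC : CorrespondsTo hV hz₀ C R) {R' : ℂ → H →L[ℂ] H}
    (hcontAt : ∀ lam ∈ Δ, ContinuousAt R' lam)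
    (hR'R : EqOn R' R ({z : ℂ | ‖z‖ < 1} ∪ {z : ℂ | 1 < ‖z‖})) :
    ∃ C' : ℂ → N V (z₀ : OnePoint ℂ) →L[ℂ] N V (invConj z₀),
      EqOn C' C {z : ℂ | ‖z‖ < 1} ∧ ContinuousOn C' ({z : ℂ | ‖z‖ < 1} ∪ Δ) ∧
      ∀ lam ∈ Δ, plus hV hz₀ (C' lam) ∈ unitary (H →L[ℂ] H) ∧
        IsUnit (pencil z₀ lam (plus hV hz₀ (C' lam))) := by
  have hc := one_sub_mul_conj_ne_zero hz₀
  -- `S` is the inverse pencil and `T` is `V⁺`, both solved for in terms of `R'`. The formulas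
  -- divide by `w` and `w - z₀`, so they are used only away from `0` and `z₀`, which is harmless
  -- near the circle.
  set S : ℂ → H →L[ℂ] H := fun w =>
    (w * (1 - z₀ * conj z₀))⁻¹ • ((w - z₀) • R' w + z₀ • 1) with hS
  set T : ℂ → H →L[ℂ] H := fun w =>
    (w - z₀)⁻¹ • ((1 - conj z₀ * w) • 1 - Ring.inverse (S w)) with hT
  have hSD : ∀ w, ‖w‖ < 1 → w ≠ 0 →
      S w = Ring.inverse (pencil z₀ w (plus hV hz₀ (C w))) := fun w hw hw0 => by
    simp only [hS]
    rw [hR'R (Or.inl hw), hC.eq_pencilResolvent hw, smul_pencilResolvent (hC.isUnit_pencil hw),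
      inv_smul_smul₀ (mul_ne_zero hw0 hc)]
  have hTD : ∀ w, ‖w‖ < 1 → w ≠ 0 → w ≠ z₀ → T w = plus hV hz₀ (C w) := fun w hw hw0 hwz => by
    simp only [hT]
    rw [hSD w hw hw0, Ring.inverse_inverse (hC.isUnit_pencil hw), pencil, sub_sub_cancel,
      inv_smul_smul₀ (sub_ne_zero.2 hwz)]
  have hne0 : ∀ lam ∈ Δ, lam ≠ 0 := fun lam h =>
    norm_ne_zero_iff.1 (by rw [hΔ.norm_eq_one h]; exact one_ne_zero)
  have hnez : ∀ lam ∈ Δ, lam - z₀ ≠ 0 := fun lam h =>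
    sub_ne_zero_of_norm_eq_one hz₀ (hΔ.norm_eq_one h)
  have hScont : ∀ lam ∈ Δ, ContinuousAt S lam := fun lam h => by
    have h1 : ContinuousAt (fun w : ℂ => (w * (1 - z₀ * conj z₀))⁻¹) lam :=
      ContinuousAt.inv₀ (by fun_prop) (mul_ne_zero (hne0 lam h) hc)
    have h2 := hcontAt lam h
    exact h1.smul (by fun_prop)
  have hev : ∀ lam ∈ Δ, ∀ᶠ w in 𝓝[{z : ℂ | ‖z‖ < 1}] lam, ‖w‖ < 1 ∧ w ≠ 0 ∧ w ≠ z₀ :=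
    fun lam h => by
      filter_upwards [self_mem_nhdsWithin, nhdsWithin_le_nhds (eventually_ne_nhds (hne0 lam h)),
        nhdsWithin_le_nhds (eventually_ne_nhds (sub_ne_zero.1 (hnez lam h)))] with w h1 h2 h3
      exact ⟨h1, h2, h3⟩
  have hSunit : ∀ lam ∈ Δ, IsUnit (S lam) := fun lam h => by
    have := nhdsWithin_disc_neBot (hΔ.norm_eq_one h)
    refine isUnit_of_tendsto (l := 𝓝[{z : ℂ | ‖z‖ < 1}] lam) (K := 4)
      ((hScont lam h).tendsto.mono_left nhdsWithin_le_nhds) ?_ ?_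
    · filter_upwards [hev lam h] with w hw
      rw [hSD w hw.1 hw.2.1]
      exact (hC.isUnit_pencil hw.1).ringInverse
    · filter_upwards [hev lam h] with w hw
      rw [hSD w hw.1 hw.2.1, Ring.inverse_inverse (hC.isUnit_pencil hw.1)]
      exact norm_pencil_le hz₀.le hw.1.le (hC.norm_plus_le_one hw.1)
  have hTcont : ∀ lam ∈ Δ, ContinuousAt T lam := fun lam h => by
    have h1 : ContinuousAt (fun w : ℂ => (w - z₀)⁻¹) lam :=
      ContinuousAt.inv₀ (by fun_prop) (hnez lam h)
    obtain ⟨u, hu⟩ := hSunit lam h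
    have hi : ContinuousAt Ring.inverse (S lam) := hu ▸ NormedRing.inverse_continuousAt u
    have h2 : ContinuousAt (fun w => Ring.inverse (S w)) lam := hi.comp (f := S) (hScont lam h)
    exact h1.smul (by fun_prop)
  -- On the arc `T` is not yet known to have the form `V⁺_{z₀;C}`, so the parameter is defined there
  -- by compressing `T`; `hplus` below recovers the form by passing to the limit from the disc.
  set comp : (H →L[ℂ] H) → N V (z₀ : OnePoint ℂ) →L[ℂ] N V (invConj z₀) := fun X =>
    (N V (invConj z₀)).orthogonalProjectionOnto ∘L X ∘L (N V (z₀ : OnePoint ℂ)).subtypeL with hcomp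
  have hcompc : Continuous comp := by fun_prop
  set C' : ℂ → N V (z₀ : OnePoint ℂ) →L[ℂ] N V (invConj z₀) := fun w =>
    if ‖w‖ < 1 then C w else comp (T w) with hC'
  have hC'C : EqOn C' C {z : ℂ | ‖z‖ < 1} := fun w hw => if_pos hw
  have hC'T : ∀ lam ∈ Δ, C' lam = comp (T lam) := fun lam h =>
    if_neg (by rw [hΔ.norm_eq_one h]; exact lt_irrefl _)
  have hC'cont : ContinuousOn C' ({z : ℂ | ‖z‖ < 1} ∪ Δ) := by
    rintro w (hw | hw)
    · have h1 : ContinuousAt C w := (hC.1.analytic w (by simpa using hw)).continuousAt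
      exact (h1.congr (Filter.eventually_of_mem (isOpen_disc.mem_nhds hw)
        fun v hv => (hC'C hv).symm)).continuousWithinAt
    · have h1 : ContinuousWithinAt (fun v => comp (T v)) ({z : ℂ | ‖z‖ < 1} ∪ Δ) w :=
        (hcompc.continuousAt.comp (hTcont w hw)).continuousWithinAt
      refine h1.congr_of_eventuallyEq ?_ (hC'T w hw)
      filter_upwards [self_mem_nhdsWithin, nhdsWithin_le_nhds (eventually_ne_nhds (hne0 w hw)),
        nhdsWithin_le_nhds (eventually_ne_nhds (sub_ne_zero.1 (hnez w hw)))] with v h1 h2 h3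
      rcases h1 with h1 | h1
      · rw [hC'C h1, hTD v h1 h2 h3]
        exact (compression_plus hV hz₀ (C v)).symm
      · exact hC'T v h1
  have hplus : ∀ lam ∈ Δ, plus hV hz₀ (C' lam) = T lam := fun lam h => by
    have := nhdsWithin_disc_neBot (hΔ.norm_eq_one h)
    have h1 : Tendsto (fun w => plus hV hz₀ (C' w)) (𝓝[{z : ℂ | ‖z‖ < 1}] lam)
        (𝓝 (plus hV hz₀ (C' lam))) :=
      ((continuous_plus hV hz₀).continuousAt.tendsto).comp
        ((hC'cont lam (Or.inr h)).mono subset_union_left)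
    have h2 : Tendsto T (𝓝[{z : ℂ | ‖z‖ < 1}] lam) (𝓝 (T lam)) :=
      (hTcont lam h).tendsto.mono_left nhdsWithin_le_nhds
    refine tendsto_nhds_unique_of_eventuallyEq h1 h2 ?_
    filter_upwards [hev lam h] with w hw
    rw [hC'C hw.1, hTD w hw.1 hw.2.1 hw.2.2]
  have hpencil : ∀ lam ∈ Δ, pencil z₀ lam (T lam) = Ring.inverse (S lam) := fun lam h => by
    simp only [hT, pencil]
    rw [smul_inv_smul₀ (hnez lam h), sub_sub_cancel]
  refine ⟨C', hC'C, hC'cont, fun lam h => ?_⟩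
  have hu : IsUnit (pencil z₀ lam (T lam)) := by
    rw [hpencil lam h]
    exact (hSunit lam h).ringInverse
  rw [hplus lam h]
  refine ⟨(pencilResolvent_add_star_iff hz₀ (hΔ.norm_eq_one h) hu).1 ?_, hu⟩
  have hRl : pencilResolvent z₀ lam (T lam) = R' lam := by
    have h1 := smul_pencilResolvent hu
    rw [hpencil lam h, Ring.inverse_inverse (hSunit lam h)] at h1
    simp only [hS] at h1
    rw [smul_inv_smul₀ (mul_ne_zero (hne0 lam h) hc), add_left_inj] at h1
    exact smul_right_injective _ (hnez lam h) h1
  -- What remains is `R'⋆ = 1 - R'` at `lam`: the limit of the reflection law as `w → lam` from the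
  -- disc, with `(conj w)⁻¹ → lam` from outside.
  rw [hRl, add_comm, ← eq_sub_iff_add_eq]
  have := nhdsWithin_disc_neBot (hΔ.norm_eq_one h)
  have hinv : Tendsto (fun w : ℂ => (conj w)⁻¹) (𝓝[{z : ℂ | ‖z‖ < 1}] lam) (𝓝 lam) := by
    have h1 : ContinuousAt (fun w : ℂ => (conj w)⁻¹) lam :=
      continuous_conj.continuousAt.inv₀ (by simpa using hne0 lam h)
    have h2 := h1.tendsto.mono_left (nhdsWithin_le_nhds (s := {z : ℂ | ‖z‖ < 1}))
    rwa [conj_inv_eq_self (hΔ.norm_eq_one h)] at h2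
  have hl : Tendsto (fun w => star (R' w)) (𝓝[{z : ℂ | ‖z‖ < 1}] lam) (𝓝 (star (R' lam))) :=
    ((hcontAt lam h).star.tendsto).mono_left nhdsWithin_le_nhds
  have hr : Tendsto (fun w => 1 - R' (conj w)⁻¹) (𝓝[{z : ℂ | ‖z‖ < 1}] lam)
      (𝓝 (1 - R' lam)) := tendsto_const_nhds.sub ((hcontAt lam h).tendsto.comp hinv)
  refine tendsto_nhds_unique_of_eventuallyEq hl hr ?_
  filter_upwards [hev lam h] with w hw
  have hw' : 1 < ‖(conj w)⁻¹‖ := by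
    rw [norm_inv, RCLike.norm_conj]
    exact (one_lt_inv₀ (norm_pos_iff.2 hw.2.1)).2 hw.1
  rw [hR'R (Or.inl hw.1), hR'R (Or.inr hw'), hR.star_eq hw.2.1 hw.1.ne]

end continuation

end IsometricGap

end

theorem theorem5p4 {H : Type*} [NormedAddCommGroup H] [InnerProductSpace ℂ H] [CompleteSpace H]
    (V : H →ₗ.[ℂ] H) (hV : IsometricGap.IsClosedIsometric V)
    (Δ : Set ℂ) (hΔ : IsometricGap.IsOpenArc Δ)
    (hreg : ∀ ζ ∈ Δ, IsometricGap.IsRegularType V ζ⁻¹)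
    (z₀ : ℂ) (hz₀ : ‖z₀‖ < 1)
    -- `ζ` runs over the arc `Δ₁`, so that `(z₀ + ζ) / (1 + ζ conj z₀)` runs over `Δ`
    (hrange : ∀ ζ ∈ (fun lam : ℂ => (lam - z₀) / (1 - conj z₀ * lam)) '' Δ,
      (IsometricGap.M V (((z₀ + ζ) / (1 + ζ * conj z₀) : ℂ) : OnePoint ℂ)).map
        (IsometricGap.proj (IsometricGap.M V (IsometricGap.invConj z₀)) : H →ₗ[ℂ] H) =
      IsometricGap.M V (IsometricGap.invConj z₀))
    (R : ℂ → H →L[ℂ] H) (hR : IsometricGap.IsGeneralizedResolvent V R)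
    (C : ℂ → IsometricGap.N V (z₀ : OnePoint ℂ) →L[ℂ]
      IsometricGap.N V (IsometricGap.invConj z₀))
    (hC : IsometricGap.CorrespondsTo hV hz₀ C R) :
    (∃ R' : ℂ → H →L[ℂ] H,
        AnalyticOnNhd ℂ R' ({z : ℂ | ‖z‖ < 1} ∪ {z : ℂ | 1 < ‖z‖} ∪ Δ) ∧
        EqOn R' R ({z : ℂ | ‖z‖ < 1} ∪ {z : ℂ | 1 < ‖z‖})) ↔
      ∃ C' : ℂ → IsometricGap.N V (z₀ : OnePoint ℂ) →L[ℂ]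
          IsometricGap.N V (IsometricGap.invConj z₀),
        EqOn C' C {z : ℂ | ‖z‖ < 1} ∧
        ContinuousOn C' ({z : ℂ | ‖z‖ < 1} ∪ Δ) ∧
        (∀ lam ∈ Δ, Isometry (C' lam) ∧ Function.Surjective (C' lam)) ∧
        (∀ lam ∈ Δ,
          Function.Injective (IsometricGap.toPMap (C' lam) - IsometricGap.W V z₀ lam).toFun ∧
          LinearMap.range (IsometricGap.toPMap (C' lam) - IsometricGap.W V z₀ lam).toFun =
            IsometricGap.N V (IsometricGap.invConj z₀)) := by
  open IsometricGap in
  have hrange' : ∀ lam ∈ Δ, (M V (lam : OnePoint ℂ)).map (proj (M V (invConj z₀)) : H →ₗ[ℂ] H) =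
      M V (invConj z₀) := by
    intro lam h
    have h1 := hrange _ ⟨lam, h, rfl⟩
    simpa only [mobius_mobius hz₀ (hΔ.norm_eq_one h).le] using h1
  constructor
  · rintro ⟨R', han, hR'R⟩
    obtain ⟨C', h1, h2, h3⟩ := IsometricGap.exists_continuous_extension hΔ hR hC
      (fun lam h => (han lam (Or.inr h)).continuousAt) hR'R
    refine ⟨C', h1, h2, fun lam h => ?_, fun lam h => ?_⟩
    · exact (IsometricGap.plus_mem_unitary_iff hV hz₀ _).1 (h3 lam h).1
    · exact (IsometricGap.isUnit_pencil_plus_iff hV hz₀ _ (hΔ.norm_eq_one h) (hreg lam h)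
        (hrange' lam h)).1 (h3 lam h).2
  · rintro ⟨C', h1, h2, h3, h4⟩
    refine IsometricGap.exists_analytic_continuation hΔ hR hC h1 h2 (fun lam h => ?_)
      fun lam h => ?_
    · exact (IsometricGap.plus_mem_unitary_iff hV hz₀ _).2 (h3 lam h)
    · exact (IsometricGap.isUnit_pencil_plus_iff hV hz₀ _ (hΔ.norm_eq_one h) (hreg lam h)
        (hrange' lam h)).2 (h4 lam h)
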